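/- Let $M$ be a compact smooth Riemannian manifold without boundary, of dimension at least $1$, let $m$ be its normalized Lebesgue measure (the Riemannian volume divided by the total volume), and let $0<\alpha\le 1$. Let $f_1,\dots,f_d:M\to M$ be local diffeomorphisms of class $C^{1+\alpha}$ (that is, $C^1$ with locally $\alpha$-Hölder derivative in charts) which are conformal: for each $i$ there is a function $a_i:M\to\mathbb R$ such that for every $x\in M$, $Df_i(x)=a_i(x)\,\mathrm{Isom}_i(x)$ with $\mathrm{Isom}_i(x):T_xM\to T_{f_i(x)}M$ a linear isometry. Let $\Gamma$ be the semigroup generated by $f_1,\dots,f_d$ under composition. For $\omega=\omega_1\omega_2\dots\in\{1,\dots,d\}^{\mathbb N}$ put $f^0_\omega=\mathrm{id}$ and $f^n_\omega=f_{\omega_n}\circ\dots\circ f_{\omega_1}$ for $n\ge 1$. Assume that 1. the action of $\Gamma$ is exact: for every non-empty open set $B\subset M$ there is a sequence $(g_n)_{n\in\mathbb N}$ in $\Gamma$ such that $m\big(M\setminus\bigcup_{n} g_n(B)\big)=0$; 2. the action of $\Gamma$ is non-uniformly expandable: for $m$-almost every $x\in M$ there is $\omega\in\{1,\dots,d\}^{\mathbb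 N}$, possibly depending on $x$, such that $$\limsup_{n\to\infty}\frac1n\sum_{i=0}^{n-1}\log\big\|Df_{\omega_{i+1}}(f^i_\omega(x))^{-1}\big\|<0 .$$ Then the action of $\Gamma$ is ergodic with respect to Lebesgue measure: every measurable set $A\subset M$ with $g(A)\subset A$ for all $g\in\Gamma$ satisfies $m(A)\in\{0,1\}$. -/

import Mathlib

open MeasureTheory Filter Topology Bundle
open scoped Manifold ContDiff NNReal ENNReal

noncomputable section

namespace SemigroupErgodicity

section Volume

variable {n : ℕ} {M : Type*} [TopologicalSpace M] [ChartedSpace (EuclideanSpace ℝ (Fin n)) M]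
  [RiemannianBundle (fun x : M ↦ TangentSpace (𝓡 n) x)]

/-- The `i`-th coordinate vector field of the preferred chart at `x`, at the point with
coordinates `u`. -/
def coordVector (x : M) (u : EuclideanSpace ℝ (Fin n)) (i : Fin n) :
    TangentSpace (𝓡 n) ((chartAt (EuclideanSpace ℝ (Fin n)) x).symm u) :=
  mfderiv (𝓡 n) (𝓡 n) (chartAt (EuclideanSpace ℝ (Fin n)) x).symm u (EuclideanSpace.single i 1)

/-- The matrix `(g_ij)` of the Riemannian metric in the preferred chart at `x`. -/
def metricMatrix (x : M) (u : EuclideanSpace ℝ (Fin n)) : Matrix (Fin n) (Fin n) ℝ :=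
  Matrix.of fun i j ↦ inner ℝ (coordVector x u i) (coordVector x u j)

variable [MeasurableSpace M]

/-- The Riemannian volume `√(det g) du` of the domain of the preferred chart at `x`, as a measure
on `M` that vanishes outside this domain. -/
def chartVolume (x : M) : Measure M :=
  ((volume.restrict (chartAt (EuclideanSpace ℝ (Fin n)) x).target).withDensity
    fun u ↦ ENNReal.ofReal √(metricMatrix x u).det).map
    (chartAt (EuclideanSpace ℝ (Fin n)) x).symm

variable (n M)

/-- The Riemannian volume of `M`. The volumes of the chart domains agree on overlaps, so on a
second countable manifold their least upper bound is the measure obtained by gluing them, i.e.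
the only measure which restricts to `√(det g) du` on each chart domain. -/
def riemannianVolume : Measure M := ⨆ x : M, chartVolume (n := n) x

/-- The normalized Lebesgue measure of a compact Riemannian manifold. -/
def lebesgueMeasure : Measure M :=
  (riemannianVolume n M Set.univ)⁻¹ • riemannianVolume n M

end Volume

section Maps

variable {M : Type*} [TopologicalSpace M]

/-- Maps of class `C^{1+α}`: continuously differentiable, with a locally `α`-Hölder derivative in
charts. -/
def IsC1Holder (n : ℕ) [ChartedSpace (EuclideanSpace ℝ (Fin n)) M] (α : ℝ≥0) (g : M → M) : Prop :=
  ContMDiff (𝓡 n) (𝓡 n) 1 g ∧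
    ∀ x : M, ∃ C : ℝ≥0, ∃ U ∈ 𝓝 (extChartAt (𝓡 n) x x),
      HolderOnWith C α (fderiv ℝ (writtenInExtChartAt (𝓡 n) (𝓡 n) x g)) U

/-- Local diffeomorphisms of class `C^{1+α}`. -/
def IsC1HolderLocalDiffeomorph (n : ℕ) [ChartedSpace (EuclideanSpace ℝ (Fin n)) M] (α : ℝ≥0)
    (g : M → M) : Prop :=
  IsLocalDiffeomorph (𝓡 n) (𝓡 n) 1 g ∧ IsC1Holder n α g

/-- Conformal maps: `Dg(x) = a(x) Isom(x)` with `Isom(x) : T_x M → T_{g(x)} M` an isometry. -/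
def IsConformal (n : ℕ) [ChartedSpace (EuclideanSpace ℝ (Fin n)) M]
    [RiemannianBundle (fun x : M ↦ TangentSpace (𝓡 n) x)] (g : M → M) : Prop :=
  ∃ a : M → ℝ, ∀ x : M, ∃ L : TangentSpace (𝓡 n) x ≃ₗᵢ[ℝ] TangentSpace (𝓡 n) (g x),
    ∀ v : TangentSpace (𝓡 n) x, mfderiv (𝓡 n) (𝓡 n) g x v = a x • L v

end Maps

section Actions

variable {M : Type*} {d : ℕ}

/-- The semigroup (under composition) generated by `f₁, …, f_d`. -/
def generatedSemigroup (f : Fin d → M → M) : Subsemigroup (Function.End M) :=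
  Subsemigroup.closure (Set.range f)

/-- The orbital branch `f^k_w = f_{w_k} ∘ ⋯ ∘ f_{w_1}` of the sequence `w = w_1 w_2 ⋯`, where `w_{i+1}`
is written `w i`. -/
def orbitalBranch (f : Fin d → M → M) (w : ℕ → Fin d) : ℕ → M → M
  | 0 => id
  | k + 1 => f (w k) ∘ orbitalBranch f w k

/-- For every non-empty open `B`, countably many images of `B` under elements of `Γ` cover `M` up
to a set of zero `m`-measure. -/
def IsExactAction [TopologicalSpace M] [MeasurableSpace M] (Γ : Subsemigroup (Function.End M))
    (m : Measure M) : Prop :=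
  ∀ B : Set M, IsOpen B → B.Nonempty →
    ∃ g : ℕ → M → M, (∀ k, g k ∈ Γ) ∧ m (⋃ k, g k '' B)ᶜ = 0

/-- Forward invariant (Lebesgue) measurable sets have measure `0` or `1`. -/
def IsErgodicAction [MeasurableSpace M] (Γ : Subsemigroup (Function.End M)) (m : Measure M) :
    Prop :=
  ∀ A : Set M, NullMeasurableSet A m → (∀ g : M → M, g ∈ Γ → g '' A ⊆ A) → m A = 0 ∨ m A = 1

/-- For almost every `x` there is `w`, which may depend on `x`, with
`limsup_k (1/k) ∑_{i<k} log ‖Df_{w_{i+1}}(f^i_w(x))⁻¹‖ < 0`. -/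
def IsNonUniformlyExpandable (n : ℕ) [TopologicalSpace M]
    [ChartedSpace (EuclideanSpace ℝ (Fin n)) M]
    [RiemannianBundle (fun x : M ↦ TangentSpace (𝓡 n) x)] [MeasurableSpace M]
    (f : Fin d → M → M) (m : Measure M) : Prop :=
  ∀ᵐ x ∂m, ∃ w : ℕ → Fin d,
    limsup (fun k : ℕ ↦ (((1 / (k : ℝ)) * ∑ i ∈ Finset.range k,
      Real.log ‖(mfderiv (𝓡 n) (𝓡 n) (f (w i)) (orbitalBranch f w i x)).inverse‖ : ℝ) : EReal))
      atTop < 0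

end Actions

end SemigroupErgodicity

end

/-! The maps enter only through estimates for the Riemannian distance, and volume only through the
Hausdorff measure `μH[n]`. An `L`-Lipschitz map multiplies `μH[n]` by at most `L ^ n`, so no
Jacobian or change of variables is needed. Since `m ≪ μH[n]`, statements that hold almost everywhere
for `μH[n]` pass to `m`.

Write `Df_i` as `exp (b_i)` times an isometry. Because `b_i` is Hölder, the mean value inequality
for `f_i` and its local inverses shows that on a ball of radius `r` around `x` the map multiplies
distances by `exp (b_i x)`, up to a factor `exp (± C r ^ α)` (`ScalesDistancesOn`). Call `N` a
hyperbolic time of an expanding orbit if the sum of `b` over each final stretch from `k` to `N` is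
at least `c (N - k)`; there are infinitely many (`frequently_le_sum_Ico`). At such times inverse
branches contract exponentially (`exists_backward_orbit`), so the errors `C r ^ α` add up to at most
a constant `D` independent of `N` (`edist_orbitalBranch_le`). With `Λ` the sum of `b` up to `N`, the
ball of fixed radius `δ'` around the `N`-th point is covered by the image, under an `exp (D +
Λ)`-Lipschitz branch, of points within `exp (D - Λ) δ'` of `x`. Conformality is what makes the two
exponents match up to `2 D`.

Let `A` be forward invariant and `x` an expanding density point of `A`. A point of the large ball
outside `A` comes from a point of the small ball outside `A`, so the part of the large ball missed
by `A` has measure tending to `0` along hyperbolic times (`hausdorffMeasure_eball_diff_le`).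
Compactness then gives a fixed ball contained in `A` up to a null set (`exists_eball_diff_null`).
Exactness spreads this ball over `M`, the exceptional null set staying null because the maps are
locally Lipschitz. -/

noncomputable section

namespace SemigroupErgodicity

/-! ### Mean value inequality for the Riemannian distance -/

section MeanValue

open Manifold Set

variable {E : Type*} [NormedAddCommGroup E] [NormedSpace ℝ E] {H : Type*} [TopologicalSpace H]
  {I : ModelWithCorners ℝ E H}
  {M : Type*} [PseudoEMetricSpace M] [ChartedSpace H M]
  [RiemannianBundle (fun x : M ↦ TangentSpace I x)] [IsRiemannianManifold I M]
  {E' : Type*} [NormedAddCommGroup E'] [NormedSpace ℝ E'] {H' : Type*} [TopologicalSpace H']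
  {I' : ModelWithCorners ℝ E' H'}
  {M' : Type*} [PseudoEMetricSpace M'] [ChartedSpace H' M']
  [RiemannianBundle (fun x : M' ↦ TangentSpace I' x)] [IsRiemannianManifold I' M']

/-- **Mean value inequality** on Riemannian manifolds. -/
theorem edist_le_mul_of_enorm_mfderiv_le {g : M → M'} {s : Set M} {K : ℝ≥0∞} {u v : M} {r : ℝ≥0∞}
    (hg : ∀ y ∈ s, ContMDiffAt I I' 1 g y) (hK : K ≠ ⊤)
    (hD : ∀ y ∈ s, ∀ w : TangentSpace I y, ‖mfderiv I I' g y w‖ₑ ≤ K * ‖w‖ₑ)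
    (hs : Metric.eball u r ⊆ s) (huv : edist u v < r) :
    edist (g u) (g v) ≤ K * edist u v := by
  -- The distance is an infimum of lengths that need not be attained, so `r'` leaves room for a
  -- nearly minimizing path. A path from `u` of length less than `r' ≤ r` stays in the ball, where
  -- the derivative bound holds. Finally `r'` decreases to `edist u v`.
  have key : ∀ r', edist u v < r' → r' ≤ r → edist (g u) (g v) ≤ K * r' := by
    intro r' h1 h2
    rw [IsRiemannianManifold.out (I := I)] at h1
    obtain ⟨γ, γ0, γ1, hγ, hlen⟩ := exists_lt_of_riemannianEDist_lt h1
    have hmem : ∀ t ∈ Icc (0 : ℝ) 1, γ t ∈ s := by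
      intro t ht
      apply hs
      rw [Metric.mem_eball', IsRiemannianManifold.out (I := I)]
      calc riemannianEDist I u (γ t) ≤ pathELength I γ 0 t :=
            riemannianEDist_le_pathELength (hγ.mono (Icc_subset_Icc_right ht.2)) γ0 rfl ht.1
        _ ≤ pathELength I γ 0 1 := pathELength_mono le_rfl ht.2
        _ < r' := hlen
        _ ≤ r := h2
    have hgγ : ContMDiffOn 𝓘(ℝ, ℝ) I' 1 (g ∘ γ) (Icc 0 1) := fun t ht ↦
      (hg _ (hmem t ht)).comp_contMDiffWithinAt t (hγ t ht)
    rw [IsRiemannianManifold.out (I := I')]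
    calc riemannianEDist I' (g u) (g v) ≤ pathELength I' (g ∘ γ) 0 1 :=
          riemannianEDist_le_pathELength hgγ (by simp [γ0]) (by simp [γ1]) zero_le_one
      _ ≤ ∫⁻ t in Icc (0 : ℝ) 1, K * ‖mfderivWithin 𝓘(ℝ, ℝ) I γ (Icc 0 1) t 1‖ₑ := by
          rw [pathELength_eq_lintegral_mfderivWithin_Icc]
          apply setLIntegral_mono' measurableSet_Icc fun t ht ↦ ?_
          have : mfderivWithin 𝓘(ℝ, ℝ) I' (g ∘ γ) (Icc 0 1) t =
              (mfderiv I I' g (γ t)) ∘L (mfderivWithin 𝓘(ℝ, ℝ) I γ (Icc 0 1) t) := by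
            apply mfderiv_comp_mfderivWithin
            · exact (hg _ (hmem t ht)).mdifferentiableAt one_ne_zero
            · exact hγ.mdifferentiableOn one_ne_zero t ht
            · rw [uniqueMDiffWithinAt_iff_uniqueDiffWithinAt]
              exact uniqueDiffOn_Icc zero_lt_one _ ht
          have h2 : mfderivWithin 𝓘(ℝ, ℝ) I' (g ∘ γ) (Icc 0 1) t 1 =
              (mfderiv I I' g (γ t)) (mfderivWithin 𝓘(ℝ, ℝ) I γ (Icc 0 1) t 1) :=
            congr($this 1)
          rw [h2]
          exact hD _ (hmem t ht) _
      _ = K * pathELength I γ 0 1 := by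
          rw [lintegral_const_mul' _ _ hK, pathELength_eq_lintegral_mfderivWithin_Icc]
      _ ≤ K * r' := by gcongr
  have hne : edist u v ≠ ⊤ := (huv.trans_le le_top).ne
  have : Tendsto (fun r' ↦ K * r') (𝓝[>] (edist u v)) (𝓝 (K * edist u v)) :=
    (ENNReal.Tendsto.const_mul tendsto_id (Or.inr hK)).mono_left nhdsWithin_le_nhds
  have : (𝓝[>] (edist u v)).NeBot := nhdsGT_neBot_of_exists_gt ⟨r, huv⟩
  refine ge_of_tendsto ‹Tendsto _ _ _› ?_
  filter_upwards [Ioc_mem_nhdsGT huv] with r' hr'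
  exact key r' hr'.1 hr'.2

/-- A map with locally bounded derivative is locally Lipschitz. -/
theorem exists_lipschitzOnWith_of_eventually_enorm_mfderiv_le {g : M → M'} {K : ℝ≥0} {p : M}
    (hg : ∀ᶠ y in 𝓝 p, ContMDiffAt I I' 1 g y)
    (hD : ∀ᶠ y in 𝓝 p, ∀ w : TangentSpace I y, ‖mfderiv I I' g y w‖ₑ ≤ K * ‖w‖ₑ) :
    ∃ U ∈ 𝓝 p, LipschitzOnWith K g U := by
  obtain ⟨r, hr, hr'⟩ := Metric.nhds_basis_eball.mem_iff.1 (hg.and hD)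
  -- For `u`, `v` in this ball, `edist u v < 2r/3`, and the ball of radius `2r/3` around `u` stays
  -- in the ball of radius `r` around `p`.
  refine ⟨Metric.eball p (r / 3), Metric.eball_mem_nhds p (ENNReal.div_pos hr.ne' (by simp)), ?_⟩
  intro u hu v hv
  have h3 : r / 3 + r / 3 + r / 3 = r := ENNReal.add_thirds r
  refine edist_le_mul_of_enorm_mfderiv_le (I := I) (I' := I') (s := Metric.eball p r)
    (r := r / 3 + r / 3) (fun y hy ↦ (hr' hy).1) ENNReal.coe_ne_top (fun y hy ↦ (hr' hy).2) ?_ ?_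
  · intro z hz
    rw [Metric.mem_eball] at *
    calc edist z p ≤ edist z u + edist u p := edist_triangle _ _ _
      _ < (r / 3 + r / 3) + r / 3 := ENNReal.add_lt_add hz hu
      _ = r := h3
  · rw [Metric.mem_eball] at *
    calc edist u v ≤ edist u p + edist v p := edist_triangle_right _ _ _
      _ < _ := ENNReal.add_lt_add hu hv

end MeanValue

/-! ### Charts and `C^1` maps are locally Lipschitz -/

section Charts

open Manifold Set

variable {n : ℕ} {M : Type*} [PseudoEMetricSpace M] [ChartedSpace (EuclideanSpace ℝ (Fin n)) M]
  [RiemannianBundle (fun x : M ↦ TangentSpace (𝓡 n) x)]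
  [IsManifold (𝓡 n) 1 M]
  [IsContinuousRiemannianBundle (EuclideanSpace ℝ (Fin n)) (fun x : M ↦ TangentSpace (𝓡 n) x)]
  [IsRiemannianManifold (𝓡 n) M]

/-- The derivative of the chart is the trivialization of the tangent bundle centered at `p`, whose
norm is locally bounded because the metric is continuous. -/
theorem exists_lipschitzOnWith_extChartAt (p : M) :
    ∃ K : ℝ≥0, ∃ U ∈ 𝓝 p, LipschitzOnWith K (extChartAt (𝓡 n) p) U := by
  obtain ⟨C, hC, h⟩ := eventually_norm_trivializationAt_lt (EuclideanSpace ℝ (Fin n))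
    (fun x : M ↦ TangentSpace (𝓡 n) x) p
  lift C to ℝ≥0 using hC.le
  refine ⟨C, exists_lipschitzOnWith_of_eventually_enorm_mfderiv_le (I := 𝓡 n) (I' := 𝓡 n) ?_ ?_⟩
  · filter_upwards [chart_source_mem_nhds (EuclideanSpace ℝ (Fin n)) p] with y hy
    exact contMDiffAt_extChartAt' hy
  · filter_upwards [h, chart_source_mem_nhds (EuclideanSpace ℝ (Fin n)) p] with y hy h'y w
    rw [enorm_tangentSpace_vectorSpace, ← TangentBundle.continuousLinearMapAt_trivializationAt h'y]
    refine (ContinuousLinearMap.le_opENorm _ _).trans ?_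
    gcongr
    simp only [enorm, nnnorm]
    exact_mod_cast hy.le

theorem exists_lipschitzOnWith_extChartAt_symm (p : M) :
    ∃ K : ℝ≥0, ∃ U ∈ 𝓝 (extChartAt (𝓡 n) p p), LipschitzOnWith K (extChartAt (𝓡 n) p).symm U := by
  obtain ⟨C, hC, h⟩ := eventually_norm_symmL_trivializationAt_lt (EuclideanSpace ℝ (Fin n))
    (fun x : M ↦ TangentSpace (𝓡 n) x) p
  lift C to ℝ≥0 using hC.le
  have ht : (extChartAt (𝓡 n) p).target ∈ 𝓝 (extChartAt (𝓡 n) p p) := extChartAt_target_mem_nhds p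
  refine ⟨C, exists_lipschitzOnWith_of_eventually_enorm_mfderiv_le (I := 𝓡 n) (I' := 𝓡 n) ?_ ?_⟩
  · filter_upwards [eventually_mem_nhds_iff.2 ht] with y hy
    exact (contMDiffOn_extChartAt_symm p).contMDiffAt hy
  · have hc : Tendsto (extChartAt (𝓡 n) p).symm (𝓝 (extChartAt (𝓡 n) p p)) (𝓝 p) := by
      have := continuousAt_extChartAt_symm (I := 𝓡 n) p
      rwa [ContinuousAt, extChartAt_to_inv] at this
    filter_upwards [hc.eventually h, hc (chart_source_mem_nhds (EuclideanSpace ℝ (Fin n)) p), ht]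
      with u hu h'u hut w
    have A : extChartAt (𝓡 n) p ((extChartAt (𝓡 n) p).symm u) = u :=
      (extChartAt (𝓡 n) p).right_inv hut
    have B : ∀ (v : EuclideanSpace ℝ (Fin n)), v = u →
        (mfderivWithin (𝓡 n) (𝓡 n) (extChartAt (𝓡 n) p).symm (range (𝓡 n)) v :
          EuclideanSpace ℝ (Fin n) →L[ℝ] EuclideanSpace ℝ (Fin n)) =
        mfderiv (𝓡 n) (𝓡 n) (extChartAt (𝓡 n) p).symm u := by
      rintro v rfl
      rw [show range (𝓡 n) = univ by simp]
      exact congrFun (mfderivWithin_univ (I := 𝓡 n) (I' := 𝓡 n)) v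
    have D := (TangentBundle.symmL_trivializationAt h'u).trans (B _ A)
    have D' : (trivializationAt (EuclideanSpace ℝ (Fin n)) (fun x : M ↦ TangentSpace (𝓡 n) x)
        p).symmL ℝ ((extChartAt (𝓡 n) p).symm u) w =
        mfderiv (𝓡 n) (𝓡 n) (extChartAt (𝓡 n) p).symm u w := congr($D w)
    rw [← D', enorm_tangentSpace_vectorSpace]
    refine (ContinuousLinearMap.le_opENorm _ _).trans ?_
    gcongr
    simp only [enorm, nnnorm]
    exact_mod_cast hu.le

/-- Maps of class `C^1` between Riemannian manifolds are locally Lipschitz. -/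
theorem exists_lipschitzOnWith_of_contMDiffAt
    {M' : Type*} [PseudoEMetricSpace M'] [ChartedSpace (EuclideanSpace ℝ (Fin n)) M']
    [RiemannianBundle (fun x : M' ↦ TangentSpace (𝓡 n) x)]
    [IsManifold (𝓡 n) 1 M']
    [IsContinuousRiemannianBundle (EuclideanSpace ℝ (Fin n)) (fun x : M' ↦ TangentSpace (𝓡 n) x)]
    [IsRiemannianManifold (𝓡 n) M'] {g : M → M'} {p : M} (hg : ContMDiffAt (𝓡 n) (𝓡 n) 1 g p) :
    ∃ K : ℝ≥0, ∃ U ∈ 𝓝 p, LipschitzOnWith K g U := by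
  obtain ⟨K₁, U₁, hU₁, h₁⟩ := exists_lipschitzOnWith_extChartAt (n := n) p
  obtain ⟨K₃, U₃, hU₃, h₃⟩ := exists_lipschitzOnWith_extChartAt_symm (n := n) (g p)
  have hw : ContDiffAt ℝ 1 (writtenInExtChartAt (𝓡 n) (𝓡 n) p g) (extChartAt (𝓡 n) p p) := by
    have := (contMDiffAt_iff.1 hg).2
    rwa [show range (𝓡 n) = univ by simp, contDiffWithinAt_univ] at this
  obtain ⟨K₂, U₂, hU₂, h₂⟩ := hw.exists_lipschitzOnWith
  have hφ : ContinuousAt (extChartAt (𝓡 n) p) p := continuousAt_extChartAt p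
  have hφ' : ContinuousAt (extChartAt (𝓡 n) (g p)) (g p) := continuousAt_extChartAt (g p)
  refine ⟨K₃ * (K₂ * K₁), U₁ ∩ (extChartAt (𝓡 n) p ⁻¹' U₂) ∩
    (g ⁻¹' (extChartAt (𝓡 n) (g p) ⁻¹' U₃)) ∩ (extChartAt (𝓡 n) p).source ∩
    g ⁻¹' (extChartAt (𝓡 n) (g p)).source,
    inter_mem (inter_mem (inter_mem (inter_mem hU₁ (hφ hU₂)) (hg.continuousAt (hφ' hU₃)))
      (extChartAt_source_mem_nhds p)) (hg.continuousAt (extChartAt_source_mem_nhds (g p))), ?_⟩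
  intro y hy z hz
  have e : ∀ y, y ∈ (extChartAt (𝓡 n) p).source →
      writtenInExtChartAt (𝓡 n) (𝓡 n) p g (extChartAt (𝓡 n) p y) = extChartAt (𝓡 n) (g p) (g y) :=
    fun y hy ↦ by
      simp only [writtenInExtChartAt, Function.comp_apply]
      rw [(extChartAt (𝓡 n) p).left_inv hy]
  have a3 := h₃ hy.1.1.2 hz.1.1.2
  have a2 := h₂ hy.1.1.1.2 hz.1.1.1.2
  have a1 := h₁ hy.1.1.1.1 hz.1.1.1.1
  rw [e y hy.1.2, e z hz.1.2] at a2
  rw [(extChartAt (𝓡 n) (g p)).left_inv hy.2, (extChartAt (𝓡 n) (g p)).left_inv hz.2] at a3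
  refine a3.trans ?_
  push_cast
  rw [mul_assoc, mul_assoc]
  gcongr
  exact a2.trans (by gcongr)

end Charts

/-! ### Regularity and positivity of the metric in charts -/

section Metric

open Manifold Set

variable {n : ℕ} {M : Type*} [TopologicalSpace M] [ChartedSpace (EuclideanSpace ℝ (Fin n)) M]

theorem contMDiffOn_coordVector [IsManifold (𝓡 n) ∞ M] (x : M) (i : Fin n) :
    ContMDiffOn (𝓡 n) ((𝓡 n).prod 𝓘(ℝ, EuclideanSpace ℝ (Fin n))) 1
      (fun u ↦ (⟨(chartAt (EuclideanSpace ℝ (Fin n)) x).symm u, coordVector x u i⟩ :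
        TangentBundle (𝓡 n) M)) (chartAt (EuclideanSpace ℝ (Fin n)) x).target := by
  set φ := chartAt (EuclideanSpace ℝ (Fin n)) x
  have h1 : ContMDiffOn (𝓡 n) (𝓡 n) ∞ φ.symm φ.target := contMDiffOn_chart_symm
  have h2 := h1.contMDiffOn_tangentMapWithin (m := 1) (by norm_num; exact ENat.LEInfty.out)
    φ.open_target.uniqueMDiffOn
  have h3 : ContMDiff (𝓡 n) ((𝓡 n).prod 𝓘(ℝ, EuclideanSpace ℝ (Fin n))) 1
      (fun u ↦ (⟨u, EuclideanSpace.single i 1⟩ :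
        TangentBundle (𝓡 n) (EuclideanSpace ℝ (Fin n)))) :=
    contMDiff_vectorSpace_iff_contDiff.2 contDiff_const
  have h4 := h2.comp h3.contMDiffOn (s := φ.target) (fun u hu ↦ hu)
  refine h4.congr fun u hu ↦ ?_
  simp only [Function.comp_apply, tangentMapWithin]
  rw [mfderivWithin_of_isOpen φ.open_target hu]
  rfl

theorem linearIndependent_coordVector [IsManifold (𝓡 n) ∞ M] (x : M) {u : EuclideanSpace ℝ (Fin n)}
    (hu : u ∈ (chartAt (EuclideanSpace ℝ (Fin n)) x).target) :
    LinearIndependent ℝ (coordVector x u) := by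
  have : IsManifold (𝓡 n) 1 M := IsManifold.of_le (n := ∞) (by simp)
  have hu' : u ∈ (extChartAt (𝓡 n) x).target := by simpa using hu
  have h := isInvertible_mfderivWithin_extChartAt_symm (I := 𝓡 n) hu'
  have hr : range (𝓡 n) = univ := by simp
  rw [hr, mfderivWithin_univ] at h
  have hinj : Function.Injective
      (mfderiv (𝓡 n) (𝓡 n) (chartAt (EuclideanSpace ℝ (Fin n)) x).symm u) := by
    exact h.injective
  have hli : LinearIndependent ℝ (fun i : Fin n ↦ EuclideanSpace.single i (1 : ℝ)) := by
    have e : (fun i : Fin n ↦ EuclideanSpace.single i (1 : ℝ)) =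
        (EuclideanSpace.basisFun (Fin n) ℝ).toBasis := by
      ext1 i
      simp
    rw [e]
    exact (EuclideanSpace.basisFun (Fin n) ℝ).toBasis.linearIndependent
  exact hli.map' (mfderiv (𝓡 n) (𝓡 n) (chartAt (EuclideanSpace ℝ (Fin n)) x).symm u).toLinearMap
    (LinearMap.ker_eq_bot.2 hinj)

variable [RiemannianBundle (fun x : M ↦ TangentSpace (𝓡 n) x)]

theorem contDiffOn_metricMatrix [IsManifold (𝓡 n) ∞ M]
    [IsContMDiffRiemannianBundle (𝓡 n) ∞ (EuclideanSpace ℝ (Fin n))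
      (fun x : M ↦ TangentSpace (𝓡 n) x)] (x : M) (i j : Fin n) :
    ContDiffOn ℝ 1 (fun u ↦ metricMatrix x u i j)
      (chartAt (EuclideanSpace ℝ (Fin n)) x).target := by
  have : IsContMDiffRiemannianBundle (𝓡 n) 1 (EuclideanSpace ℝ (Fin n))
      (fun x : M ↦ TangentSpace (𝓡 n) x) := IsContMDiffRiemannianBundle.of_le (n := ∞) (by simp)
  rw [← contMDiffOn_iff_contDiffOn]
  exact (contMDiffOn_coordVector x i).inner_bundle (contMDiffOn_coordVector x j)

theorem posDef_metricMatrix [IsManifold (𝓡 n) ∞ M] (x : M) {u : EuclideanSpace ℝ (Fin n)}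
    (hu : u ∈ (chartAt (EuclideanSpace ℝ (Fin n)) x).target) : (metricMatrix x u).PosDef :=
  Matrix.posDef_gram_of_linearIndependent (linearIndependent_coordVector x hu)

theorem isContinuousRiemannianBundle_of_contMDiff [IsManifold (𝓡 n) 1 M]
    [h : IsContMDiffRiemannianBundle (𝓡 n) ∞ (EuclideanSpace ℝ (Fin n))
      (fun x : M ↦ TangentSpace (𝓡 n) x)] :
    IsContinuousRiemannianBundle (EuclideanSpace ℝ (Fin n))
      (fun x : M ↦ TangentSpace (𝓡 n) x) := by
  obtain ⟨g, hg, hg'⟩ := h.exists_contMDiff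
  exact ⟨g, hg.continuous, hg'⟩

end Metric

/-! ### Local Hölder maps and their compositions -/

section Holder

variable {X Y Z : Type*} [PseudoEMetricSpace X] [PseudoEMetricSpace Y] [PseudoEMetricSpace Z]

/-- The map `F` is `α`-Hölder in a neighbourhood of `p`. -/
def IsHolderNear (α : ℝ≥0) (F : X → Y) (p : X) : Prop :=
  ∃ C : ℝ≥0, ∃ U ∈ 𝓝 p, HolderOnWith C α F U

theorem IsHolderNear.prodMk {α : ℝ≥0} {F : X → Y} {G : X → Z} {p : X} (hF : IsHolderNear α F p)
    (hG : IsHolderNear α G p) : IsHolderNear α (fun x ↦ (F x, G x)) p := by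
  obtain ⟨C, U, hU, hC⟩ := hF
  obtain ⟨D, V, hV, hD⟩ := hG
  refine ⟨max C D, U ∩ V, inter_mem hU hV, fun x hx y hy ↦ ?_⟩
  rw [Prod.edist_eq, max_le_iff]
  exact ⟨(hC.mono_const (le_max_left C D)).edist_le hx.1 hy.1,
    (hD.mono_const (le_max_right C D)).edist_le hx.2 hy.2⟩

theorem IsHolderNear.continuousAt {α : ℝ≥0} (hα : 0 < α) {F : X → Y} {p : X}
    (hF : IsHolderNear α F p) : ContinuousAt F p := by
  obtain ⟨C, U, hU, hC⟩ := hF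
  exact (hC.continuousOn hα).continuousAt hU

theorem isHolderNear_of_lipschitzOnWith {α : ℝ≥0} (hα : α ≤ 1) {F : X → Y} {p : X} {K : ℝ≥0}
    {U : Set X} (hU : U ∈ 𝓝 p) (h : LipschitzOnWith K F U) : IsHolderNear α F p := by
  refine ⟨_, U ∩ Metric.eball p 1, inter_mem hU (Metric.eball_mem_nhds p one_pos),
    ((h.mono Set.inter_subset_left).holderOnWith).of_le (D := 2) (fun x hx y hy ↦ ?_) hα⟩
  calc edist x y ≤ edist x p + edist y p := edist_triangle_right _ _ _
    _ ≤ 1 + 1 := add_le_add hx.2.le hy.2.le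
    _ = ((2 : ℝ≥0) : ℝ≥0∞) := by norm_num

theorem IsHolderNear.lipschitz_comp {α : ℝ≥0} (hα : 0 < α) {F : X → Y} {p : X}
    (hF : IsHolderNear α F p) {G : Y → Z} {K : ℝ≥0} {V : Set Y} (hV : V ∈ 𝓝 (F p))
    (hG : LipschitzOnWith K G V) : IsHolderNear α (fun x ↦ G (F x)) p := by
  have hc := hF.continuousAt hα
  obtain ⟨C, U, hU, hC⟩ := hF
  refine ⟨K * C, U ∩ F ⁻¹' V, inter_mem hU (hc hV), fun x hx y hy ↦ ?_⟩
  refine (hG hx.2 hy.2).trans ?_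
  push_cast
  rw [mul_assoc]
  gcongr
  exact hC.edist_le hx.1 hy.1

theorem IsHolderNear.comp_lipschitz {α : ℝ≥0} {F : X → Y} {p : X} {G : Y → Z}
    (hG : IsHolderNear α G (F p)) {K : ℝ≥0} {V : Set X} (hV : V ∈ 𝓝 p)
    (hF : LipschitzOnWith K F V) : IsHolderNear α (fun x ↦ G (F x)) p := by
  have hc := (hF.continuousOn).continuousAt hV
  obtain ⟨C, U, hU, hC⟩ := hG
  refine ⟨C * K ^ (α : ℝ), V ∩ F ⁻¹' U, inter_mem hV (hc hU), fun x hx y hy ↦ ?_⟩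
  refine (hC.edist_le hx.2 hy.2).trans ?_
  push_cast
  rw [ENNReal.coe_rpow_of_nonneg _ α.coe_nonneg, mul_assoc, ← ENNReal.mul_rpow_of_nonneg _ _ α.coe_nonneg]
  gcongr
  exact hF hx.1 hy.1

theorem IsHolderNear.congr {α : ℝ≥0} {F G : X → Y} {p : X} (hF : IsHolderNear α F p)
    (h : F =ᶠ[𝓝 p] G) : IsHolderNear α G p := by
  obtain ⟨C, U, hU, hC⟩ := hF
  refine ⟨C, U ∩ {x | F x = G x}, inter_mem hU h, fun x hx y hy ↦ ?_⟩
  have hx2 : F x = G x := hx.2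
  have hy2 : F y = G y := hy.2
  rw [← hx2, ← hy2]
  exact hC.edist_le hx.1 hy.1

end Holder

/-! ### Hölder regularity of the logarithmic conformal factor -/

section ConformalFactor

open Manifold Set

variable {n : ℕ} {M : Type*}

section

variable [TopologicalSpace M] [ChartedSpace (EuclideanSpace ℝ (Fin n)) M]

/-- With `φ`, `ψ` the charts at `p` and `g p`, and `G` the map in coordinates, both sides
differentiate the same map: near `u`, `g ∘ φ.symm` equals `ψ.symm ∘ G`. -/
theorem mfderiv_apply_mfderiv_symm [IsManifold (𝓡 n) 1 M] {g : M → M}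
    (hg : ContMDiff (𝓡 n) (𝓡 n) 1 g) (p : M) {u : EuclideanSpace ℝ (Fin n)}
    (hu : u ∈ (chartAt (EuclideanSpace ℝ (Fin n)) p).target)
    (hgu : g ((chartAt (EuclideanSpace ℝ (Fin n)) p).symm u) ∈
      (chartAt (EuclideanSpace ℝ (Fin n)) (g p)).source)
    (e : EuclideanSpace ℝ (Fin n)) :
    (mfderiv (𝓡 n) (𝓡 n) g ((chartAt (EuclideanSpace ℝ (Fin n)) p).symm u)
      (mfderiv (𝓡 n) (𝓡 n) (chartAt (EuclideanSpace ℝ (Fin n)) p).symm u e) :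
      EuclideanSpace ℝ (Fin n)) =
    mfderiv (𝓡 n) (𝓡 n) (chartAt (EuclideanSpace ℝ (Fin n)) (g p)).symm
      (writtenInExtChartAt (𝓡 n) (𝓡 n) p g u)
      (fderiv ℝ (writtenInExtChartAt (𝓡 n) (𝓡 n) p g) u e) := by
  set φ := chartAt (EuclideanSpace ℝ (Fin n)) p
  set ψ := chartAt (EuclideanSpace ℝ (Fin n)) (g p)
  have hw : writtenInExtChartAt (𝓡 n) (𝓡 n) p g = ψ ∘ g ∘ φ.symm := by
    ext1 v; simp [writtenInExtChartAt, φ, ψ]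
  rw [hw]
  have hφ : MDifferentiableAt (𝓡 n) (𝓡 n) φ.symm u :=
    mdifferentiableAt_atlas_symm (chart_mem_atlas _ p) hu
  have hgd : MDifferentiableAt (𝓡 n) (𝓡 n) g (φ.symm u) := (hg _).mdifferentiableAt one_ne_zero
  have hψ : MDifferentiableAt (𝓡 n) (𝓡 n) ψ (g (φ.symm u)) :=
    mdifferentiableAt_atlas (chart_mem_atlas _ (g p)) hgu
  have hψ' : MDifferentiableAt (𝓡 n) (𝓡 n) ψ.symm ((ψ ∘ g ∘ φ.symm) u) :=
    mdifferentiableAt_atlas_symm (chart_mem_atlas _ (g p)) (ψ.map_source hgu)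
  have hgφ : MDifferentiableAt (𝓡 n) (𝓡 n) (g ∘ φ.symm) u := hgd.comp u hφ
  have h1 : mfderiv (𝓡 n) (𝓡 n) (g ∘ φ.symm) u = _ := mfderiv_comp u hgd hφ
  have h2 : mfderiv (𝓡 n) (𝓡 n) (ψ.symm ∘ (ψ ∘ g ∘ φ.symm)) u = _ :=
    mfderiv_comp u hψ' (hψ.comp u hgφ)
  have h3 : g ∘ φ.symm =ᶠ[𝓝 u] ψ.symm ∘ (ψ ∘ g ∘ φ.symm) := by
    have : (g ∘ φ.symm) ⁻¹' ψ.source ∈ 𝓝 u :=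
      hgφ.continuousAt (ψ.open_source.mem_nhds hgu)
    filter_upwards [this] with v hv
    exact (ψ.left_inv hv).symm
  have h4 := h3.mfderiv_eq (I := 𝓡 n) (I' := 𝓡 n)
  have h5 := (h1.symm.trans h4).trans h2
  rw [mfderiv_eq_fderiv] at h5
  exact congr($h5 e)

variable [RiemannianBundle (fun x : M ↦ TangentSpace (𝓡 n) x)]

/-- The Riemannian norm at the point `x` of a vector given in coordinates. -/
def tangentNorm (x : M) (v : EuclideanSpace ℝ (Fin n)) : ℝ :=
  ‖(show TangentSpace (𝓡 n) x from v)‖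

theorem tangentNorm_sq_mfderiv_symm (x : M) (u c : EuclideanSpace ℝ (Fin n)) :
    tangentNorm ((chartAt (EuclideanSpace ℝ (Fin n)) x).symm u)
      (mfderiv (𝓡 n) (𝓡 n) (chartAt (EuclideanSpace ℝ (Fin n)) x).symm u c) ^ 2 =
      ∑ j, ∑ k, c j * c k * metricMatrix x u j k := by
  have hc : c = ∑ j, c j • EuclideanSpace.single j (1 : ℝ) := by
    ext i
    simp [Finset.sum_apply, Pi.single_apply]
  have : mfderiv (𝓡 n) (𝓡 n) (chartAt (EuclideanSpace ℝ (Fin n)) x).symm u c =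
      ∑ j, c j • coordVector x u j := by
    conv_lhs => rw [hc]
    exact (map_sum _ _ _).trans (Finset.sum_congr rfl fun j _ ↦ map_smul _ _ _)
  rw [this]
  change ‖∑ j, c j • coordVector x u j‖ ^ 2 = _
  rw [← real_inner_self_eq_norm_sq, sum_inner]
  refine Finset.sum_congr rfl fun j _ ↦ ?_
  rw [inner_sum]
  refine Finset.sum_congr rfl fun k _ ↦ ?_
  rw [real_inner_smul_left, real_inner_smul_right, mul_assoc]
  rfl

/-- The squared length of the image of a coordinate vector is computed once by conformality and once
in coordinates. This expresses `b` through the coordinate derivative and the metric, whose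
regularity is known. -/
theorem exp_two_mul_logFactor_mul_metricMatrix [IsManifold (𝓡 n) 1 M] {g : M → M}
    (hg : ContMDiff (𝓡 n) (𝓡 n) 1 g) {b : M → ℝ}
    (hb : ∀ x, ∀ v : TangentSpace (𝓡 n) x, ‖mfderiv (𝓡 n) (𝓡 n) g x v‖ = Real.exp (b x) * ‖v‖)
    (p : M) {u : EuclideanSpace ℝ (Fin n)}
    (hu : u ∈ (chartAt (EuclideanSpace ℝ (Fin n)) p).target)
    (hgu : g ((chartAt (EuclideanSpace ℝ (Fin n)) p).symm u) ∈
      (chartAt (EuclideanSpace ℝ (Fin n)) (g p)).source) (i : Fin n) :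
    Real.exp (2 * b ((chartAt (EuclideanSpace ℝ (Fin n)) p).symm u)) * metricMatrix p u i i =
    ∑ j, ∑ k, fderiv ℝ (writtenInExtChartAt (𝓡 n) (𝓡 n) p g) u (EuclideanSpace.single i 1) j *
      fderiv ℝ (writtenInExtChartAt (𝓡 n) (𝓡 n) p g) u (EuclideanSpace.single i 1) k *
      metricMatrix (g p) (writtenInExtChartAt (𝓡 n) (𝓡 n) p g u) j k := by
  rw [← tangentNorm_sq_mfderiv_symm,
    ← mfderiv_apply_mfderiv_symm hg p hu hgu (EuclideanSpace.single i 1)]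
  have e : (chartAt (EuclideanSpace ℝ (Fin n)) (g p)).symm
      (writtenInExtChartAt (𝓡 n) (𝓡 n) p g u) =
      g ((chartAt (EuclideanSpace ℝ (Fin n)) p).symm u) := by
    simp only [writtenInExtChartAt, Function.comp_apply]
    simpa using (chartAt (EuclideanSpace ℝ (Fin n)) (g p)).left_inv hgu
  rw [e]
  have h := hb ((chartAt (EuclideanSpace ℝ (Fin n)) p).symm u) (coordVector p u i)
  change _ = ‖mfderiv (𝓡 n) (𝓡 n) g ((chartAt (EuclideanSpace ℝ (Fin n)) p).symm u)
    (coordVector p u i)‖ ^ 2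
  rw [h, mul_pow, ← real_inner_self_eq_norm_sq, ← Real.exp_nat_mul]
  rfl

end

/-- Solving the preceding identity for `b` gives half a difference of logarithms, a `C^1` function
of the triple `(DG, u, G u)`. Of its entries only `DG` is merely Hölder. -/
theorem isHolderNear_logFactor [PseudoEMetricSpace M] [ChartedSpace (EuclideanSpace ℝ (Fin n)) M]
    [IsManifold (𝓡 n) ∞ M] [RiemannianBundle (fun x : M ↦ TangentSpace (𝓡 n) x)]
    [IsContMDiffRiemannianBundle (𝓡 n) ∞ (EuclideanSpace ℝ (Fin n))
      (fun x : M ↦ TangentSpace (𝓡 n) x)] [IsRiemannianManifold (𝓡 n) M]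
    (hn : 0 < n) {α : ℝ≥0} (hα0 : 0 < α) (hα1 : α ≤ 1) {g : M → M} (hg : IsC1Holder n α g)
    {b : M → ℝ}
    (hb : ∀ x, ∀ v : TangentSpace (𝓡 n) x, ‖mfderiv (𝓡 n) (𝓡 n) g x v‖ = Real.exp (b x) * ‖v‖)
    (p : M) : IsHolderNear α b p := by
  have : IsManifold (𝓡 n) 1 M := IsManifold.of_le (n := ∞) (by simp)
  have : IsContinuousRiemannianBundle (EuclideanSpace ℝ (Fin n))
    (fun x : M ↦ TangentSpace (𝓡 n) x) := isContinuousRiemannianBundle_of_contMDiff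
  set φ := chartAt (EuclideanSpace ℝ (Fin n)) p with hφ
  set ψ := chartAt (EuclideanSpace ℝ (Fin n)) (g p) with hψ
  set G := writtenInExtChartAt (𝓡 n) (𝓡 n) p g with hG
  -- The factor is the same in all directions, so one coordinate vector determines it.
  let i : Fin n := ⟨0, hn⟩
  let e : EuclideanSpace ℝ (Fin n) := EuclideanSpace.single i 1
  let Q : (EuclideanSpace ℝ (Fin n) →L[ℝ] EuclideanSpace ℝ (Fin n)) ×
      EuclideanSpace ℝ (Fin n) × EuclideanSpace ℝ (Fin n) → ℝ := fun z ↦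
    ∑ j, ∑ k, z.1 e j * z.1 e k * metricMatrix (g p) z.2.2 j k
  let h : (EuclideanSpace ℝ (Fin n) →L[ℝ] EuclideanSpace ℝ (Fin n)) ×
      EuclideanSpace ℝ (Fin n) × EuclideanSpace ℝ (Fin n) → ℝ := fun z ↦
    (Real.log (Q z) - Real.log (metricMatrix p z.2.1 i i)) / 2
  have hpt : φ p ∈ φ.target := φ.map_source (mem_chart_source _ p)
  have hpg : g (φ.symm (φ p)) ∈ ψ.source := by
    rw [φ.left_inv (mem_chart_source _ p)]
    exact mem_chart_source _ (g p)
  have hGp : G (φ p) ∈ ψ.target := by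
    simp only [hG, writtenInExtChartAt, Function.comp_apply]
    simpa using ψ.map_source hpg
  have hGdiff : ContDiffAt ℝ 1 G (φ p) := by
    have := (contMDiffAt_iff.1 (hg.1 p)).2
    rwa [show range (𝓡 n) = univ by simp, contDiffWithinAt_univ] at this
  obtain ⟨K, U, hU, hK⟩ := hGdiff.exists_lipschitzOnWith
  obtain ⟨C, V, hV, hC⟩ := hg.2 p
  have hF : IsHolderNear α (fun u ↦ (fderiv ℝ G u, u, G u)) (φ p) :=
    IsHolderNear.prodMk ⟨C, V, hV, hC⟩
      ((isHolderNear_of_lipschitzOnWith hα1 univ_mem (LipschitzWith.id.lipschitzOnWith)).prodMk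
        (isHolderNear_of_lipschitzOnWith hα1 hU hK))
  have hpos : 0 < metricMatrix p (φ p) i i := (posDef_metricMatrix p hpt).diag_pos
  have hQpos : 0 < Q (fderiv ℝ G (φ p), φ p, G (φ p)) := by
    have := exp_two_mul_logFactor_mul_metricMatrix hg.1 hb p hpt hpg i
    change 0 < ∑ j, ∑ k, _
    rw [← this]
    positivity
  have hm : ∀ (x : M) (j k : Fin n) (u : EuclideanSpace ℝ (Fin n)),
      u ∈ (chartAt (EuclideanSpace ℝ (Fin n)) x).target →
      ContDiffAt ℝ 1 (fun u ↦ metricMatrix x u j k) u := fun x j k u hu ↦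
    (contDiffOn_metricMatrix x j k).contDiffAt
      ((chartAt (EuclideanSpace ℝ (Fin n)) x).open_target.mem_nhds hu)
  have hh : ContDiffAt ℝ 1 h (fderiv ℝ G (φ p), φ p, G (φ p)) := by
    have hQd : ContDiffAt ℝ 1 Q (fderiv ℝ G (φ p), φ p, G (φ p)) := by
      refine ContDiffAt.sum fun j _ ↦ ContDiffAt.sum fun k _ ↦ ?_
      have hc : ∀ l : Fin n, ContDiff ℝ 1 (fun z : (EuclideanSpace ℝ (Fin n) →L[ℝ]
          EuclideanSpace ℝ (Fin n)) × EuclideanSpace ℝ (Fin n) × EuclideanSpace ℝ (Fin n) ↦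
            z.1 e l) := fun l ↦ by fun_prop
      refine ((hc j).contDiffAt.mul (hc k).contDiffAt).mul ?_
      exact (hm (g p) j k _ hGp).comp (fderiv ℝ G (φ p), φ p, G (φ p))
        (contDiff_snd.snd.contDiffAt)
    have hPd : ContDiffAt ℝ 1 (fun z : (EuclideanSpace ℝ (Fin n) →L[ℝ]
          EuclideanSpace ℝ (Fin n)) × EuclideanSpace ℝ (Fin n) × EuclideanSpace ℝ (Fin n) ↦
            metricMatrix p z.2.1 i i) (fderiv ℝ G (φ p), φ p, G (φ p)) :=
      (hm p i i _ hpt).comp (fderiv ℝ G (φ p), φ p, G (φ p)) (contDiff_snd.fst.contDiffAt)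
    exact ((hQd.log hQpos.ne').sub (hPd.log hpos.ne')).div_const 2
  obtain ⟨K', W, hW, hK'⟩ := hh.exists_lipschitzOnWith
  have hcomp := hF.lipschitz_comp hα0 hW hK'
  obtain ⟨K₁, U₁, hU₁, h₁⟩ := exists_lipschitzOnWith_extChartAt (n := n) p
  have hcomp2 : IsHolderNear α (fun y ↦ h (fderiv ℝ G (φ y), φ y, G (φ y))) p :=
    hcomp.comp_lipschitz (F := φ) hU₁ h₁
  refine hcomp2.congr ?_
  filter_upwards [φ.open_source.mem_nhds (mem_chart_source _ p),
    hg.1.continuous.continuousAt (ψ.open_source.mem_nhds (mem_chart_source _ (g p)))] with y hy hgy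
  have hy' : φ.symm (φ y) = y := φ.left_inv hy
  have key := exp_two_mul_logFactor_mul_metricMatrix hg.1 hb p (φ.map_source hy)
    (by rw [hy']; exact hgy) i
  have hpos' : 0 < metricMatrix p (φ y) i i := (posDef_metricMatrix p (φ.map_source hy)).diag_pos
  rw [← hφ, hy'] at key
  change (Real.log (∑ j, ∑ k, _) - _) / 2 = b y
  rw [← key, Real.log_mul (Real.exp_ne_zero _) hpos'.ne', Real.log_exp]
  ring

end ConformalFactor

/-! ### Distances are scaled by the conformal factor -/

section LocalEstimate

/-- On balls of radius `r` centered at `x`, the map `f` multiplies distances by `exp (b x)`, up to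
an error of order `r ^ α` in the exponent. -/
def ScalesDistancesOn {X : Type*} [PseudoEMetricSpace X] (α : ℝ≥0) (f : X → X) (b : X → ℝ)
    (C δ : ℝ) (s : Set X) : Prop :=
  ∀ x ∈ s, ∀ r : ℝ, 0 < r → r ≤ δ → ∀ y ∈ Metric.eball x (ENNReal.ofReal r),
    ∀ z ∈ Metric.eball x (ENNReal.ofReal r),
      edist (f y) (f z) ≤ ENNReal.ofReal (Real.exp (b x + C * r ^ (α : ℝ))) * edist y z ∧
      edist y z ≤ ENNReal.ofReal (Real.exp (-b x + C * r ^ (α : ℝ))) * edist (f y) (f z)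

theorem ScalesDistancesOn.mono {X : Type*} [PseudoEMetricSpace X] {α : ℝ≥0} {f : X → X} {b : X → ℝ}
    {C C' δ δ' : ℝ} {s s' : Set X} (h : ScalesDistancesOn α f b C δ s) (hC : C ≤ C') (hδ : δ' ≤ δ)
    (hs : s' ⊆ s) : ScalesDistancesOn α f b C' δ' s' := by
  intro x hx r hr0 hr y hy z hz
  obtain ⟨h1, h2⟩ := h x (hs hx) r hr0 (hr.trans hδ) y hy z hz
  constructor
  · refine h1.trans ?_
    gcongr
  · refine h2.trans ?_
    gcongr

theorem exists_eball_ofReal_subset {X : Type*} [PseudoEMetricSpace X] {p : X} {U : Set X}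
    (hU : U ∈ 𝓝 p) : ∃ r : ℝ, 0 < r ∧ Metric.eball p (ENNReal.ofReal r) ⊆ U := by
  obtain ⟨ε, hε, h⟩ := Metric.nhds_basis_eball.mem_iff.1 hU
  refine ⟨(min ε 1).toReal, ENNReal.toReal_pos (by positivity) (by simp), ?_⟩
  rw [ENNReal.ofReal_toReal (by simp)]
  exact (Metric.eball_subset_eball (min_le_left _ _)).trans h

theorem HolderOnWith.le_add_mul_rpow {X : Type*} [PseudoEMetricSpace X] {b : X → ℝ} {C α : ℝ≥0}
    {U : Set X} (h : HolderOnWith C α b U) {x y : X} (hx : x ∈ U) (hy : y ∈ U) {t : ℝ}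
    (ht : 0 ≤ t) (hxy : edist x y ≤ ENNReal.ofReal t) : b x ≤ b y + C * t ^ (α : ℝ) := by
  have h1 := h.edist_le_of_le hx hy hxy
  rw [ENNReal.ofReal_rpow_of_nonneg ht α.coe_nonneg, ← ENNReal.ofReal_coe_nnreal,
    ← ENNReal.ofReal_mul C.coe_nonneg, edist_le_ofReal (by positivity), Real.dist_eq] at h1
  linarith [le_abs_self (b x - b y)]

open Manifold Set

variable {n : ℕ} {M : Type*}

theorem norm_mfderiv_localInverse [TopologicalSpace M] [ChartedSpace (EuclideanSpace ℝ (Fin n)) M]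
    [RiemannianBundle (fun x : M ↦ TangentSpace (𝓡 n) x)] {f : M → M} {p : M}
    (hf : IsLocalDiffeomorph (𝓡 n) (𝓡 n) 1 f) {b : M → ℝ}
    (hb : ∀ x, ∀ v : TangentSpace (𝓡 n) x, ‖mfderiv (𝓡 n) (𝓡 n) f x v‖ = Real.exp (b x) * ‖v‖)
    {u : M} (hu : u ∈ (hf p).localInverse.source) (w : TangentSpace (𝓡 n) u) :
    ‖mfderiv (𝓡 n) (𝓡 n) (hf p).localInverse u w‖ =
      Real.exp (-b ((hf p).localInverse u)) * ‖w‖ := by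
  set h := (hf p).localInverse
  have hs : h.source ∈ 𝓝 u := h.open_source.mem_nhds hu
  have hh : MDifferentiableAt (𝓡 n) (𝓡 n) h u :=
    (h.contMDiffOn_toFun.contMDiffAt hs).mdifferentiableAt one_ne_zero
  have h1 : mfderiv (𝓡 n) (𝓡 n) (f ∘ h) u = _ :=
    mfderiv_comp u ((hf (h u)).mdifferentiableAt one_ne_zero) hh
  have h2 : f ∘ h =ᶠ[𝓝 u] id := by
    filter_upwards [hs] with v hv using (hf p).localInverse_right_inv hv
  have h3 := (h1.symm.trans (h2.mfderiv_eq (I := 𝓡 n) (I' := 𝓡 n))).trans (mfderiv_id (I := 𝓡 n))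
  have h4 : mfderiv (𝓡 n) (𝓡 n) f (h u) (mfderiv (𝓡 n) (𝓡 n) h u w) = w := congr($h3 w)
  have h5 := hb (h u) (mfderiv (𝓡 n) (𝓡 n) h u w)
  -- `tangentNorm` separates the vector from its base point, so the equality `f (h u) = u` can be
  -- rewritten.
  have h6 : tangentNorm (f (h u)) (mfderiv (𝓡 n) (𝓡 n) f (h u) (mfderiv (𝓡 n) (𝓡 n) h u w)) =
      tangentNorm u w := by
    rw [h4, (hf p).localInverse_right_inv hu]
  change ‖_‖ = ‖_‖ at h6
  rw [h5] at h6
  rw [Real.exp_neg, ← h6, inv_mul_cancel_left₀ (Real.exp_ne_zero _)]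

variable [PseudoEMetricSpace M] [ChartedSpace (EuclideanSpace ℝ (Fin n)) M]
  [IsManifold (𝓡 n) 1 M] [RiemannianBundle (fun x : M ↦ TangentSpace (𝓡 n) x)]
  [IsContinuousRiemannianBundle (EuclideanSpace ℝ (Fin n)) (fun x : M ↦ TangentSpace (𝓡 n) x)]
  [IsRiemannianManifold (𝓡 n) M]

/-- The mean value inequality is applied to `f` and to its local inverse; on the relevant balls the
Hölder bound compares the logarithmic factor with its value at the center. -/
theorem exists_scalesDistancesOn_nhds {α : ℝ≥0} {f : M → M}
    (hf : IsLocalDiffeomorph (𝓡 n) (𝓡 n) 1 f) {b : M → ℝ}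
    (hb : ∀ x, ∀ v : TangentSpace (𝓡 n) x, ‖mfderiv (𝓡 n) (𝓡 n) f x v‖ = Real.exp (b x) * ‖v‖)
    {p : M} (hα : IsHolderNear α b p) :
    ∃ C : ℝ, ∃ δ : ℝ, 0 < δ ∧ ∃ U ∈ 𝓝 p, ScalesDistancesOn α f b C δ U := by
  obtain ⟨C, U, hU, hC⟩ := hα
  set h := (hf p).localInverse
  have hfp : f p ∈ h.source := (hf p).localInverse_mem_source
  have hhp : h (f p) = p := (hf p).localInverse_left_inv (hf p).localInverse_mem_target
  obtain ⟨K₁', N₁, hN₁, hK₁'⟩ := exists_lipschitzOnWith_of_contMDiffAt (hf p).contMDiffAt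
  obtain ⟨K₀, N₀, hN₀, hK₀⟩ :=
    exists_lipschitzOnWith_of_contMDiffAt (hf p).localInverse_contMDiffAt
  obtain ⟨K₁, hK₁pos, hK₁⟩ : ∃ K₁ : ℝ≥0, 0 < K₁ ∧ LipschitzOnWith K₁ f N₁ :=
    ⟨K₁' + 1, by positivity, hK₁'.weaken (by simp)⟩
  have hcont : ContinuousAt h (f p) := (hf p).localInverse_contMDiffAt.continuousAt
  obtain ⟨R, hR, hRs⟩ := exists_eball_ofReal_subset
    (inter_mem (inter_mem hU hN₁) (h.open_target.mem_nhds (hf p).localInverse_mem_target))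
  obtain ⟨ρ, hρ, hρs⟩ := exists_eball_ofReal_subset
    (inter_mem (inter_mem (h.open_source.mem_nhds hfp) hN₀)
      (hcont (by rw [hhp]; exact hU)))
  -- `A * r` bounds the distance to `x` both of points of the ball of radius `3 r` and of the
  -- images, under the `K₀`-Lipschitz inverse, of points within `3 K₁ r` of `f x`.
  set A : ℝ := 3 + 3 * K₀ * K₁ with hA
  have hApos : 0 < A := by positivity
  refine ⟨C * A ^ (α : ℝ), min (R / 4) (ρ / (4 * K₁)), by positivity,
    Metric.eball p (ENNReal.ofReal (R / 4)) ∩ f ⁻¹' Metric.eball (f p) (ENNReal.ofReal (ρ / 4)),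
    inter_mem (Metric.eball_mem_nhds _ (by simpa using hR))
      ((hf p).contMDiffAt.continuousAt (Metric.eball_mem_nhds _ (by simpa using hρ))), ?_⟩
  rintro x ⟨hxp, hfx⟩ r hr0 hr y hy z hz
  have hrR : r ≤ R / 4 := hr.trans (min_le_left _ _)
  have hrρ : K₁ * r ≤ ρ / 4 := by
    have := hr.trans (min_le_right _ _)
    rw [le_div_iff₀ (by positivity)] at this
    linarith
  have hpow : (C : ℝ) * A ^ (α : ℝ) * r ^ (α : ℝ) = C * (A * r) ^ (α : ℝ) := by
    rw [Real.mul_rpow hApos.le hr0.le, mul_assoc]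
  rw [hpow]
  -- the balls on which the derivatives of `f` and of its local inverse are controlled
  have hb1 : Metric.eball x (ENNReal.ofReal (3 * r)) ⊆ Metric.eball p (ENNReal.ofReal R) := by
    intro u hu
    rw [Metric.mem_eball] at *
    calc edist u p ≤ edist u x + edist x p := edist_triangle _ _ _
      _ < ENNReal.ofReal (3 * r) + ENNReal.ofReal (R / 4) := ENNReal.add_lt_add hu hxp
      _ = ENNReal.ofReal (3 * r + R / 4) := (ENNReal.ofReal_add (by positivity) (by positivity)).symm
      _ ≤ ENNReal.ofReal R := ENNReal.ofReal_le_ofReal (by linarith)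
  have hb2 : Metric.eball (f x) (ENNReal.ofReal (3 * (K₁ * r))) ⊆
      Metric.eball (f p) (ENNReal.ofReal ρ) := by
    intro u hu
    rw [mem_preimage] at hfx
    rw [Metric.mem_eball] at *
    calc edist u (f p) ≤ edist u (f x) + edist (f x) (f p) := edist_triangle _ _ _
      _ < ENNReal.ofReal (3 * (K₁ * r)) + ENNReal.ofReal (ρ / 4) := ENNReal.add_lt_add hu hfx
      _ = ENNReal.ofReal (3 * (K₁ * r) + ρ / 4) :=
        (ENNReal.ofReal_add (by positivity) (by positivity)).symm
      _ ≤ ENNReal.ofReal ρ := ENNReal.ofReal_le_ofReal (by linarith)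
  have hxU : x ∈ Metric.eball p (ENNReal.ofReal R) :=
    hb1 (Metric.mem_eball_self (by simpa using hr0))
  have hyU : y ∈ Metric.eball p (ENNReal.ofReal R) :=
    hb1 (Metric.eball_subset_eball (ENNReal.ofReal_le_ofReal (by linarith)) hy)
  have hzU : z ∈ Metric.eball p (ENNReal.ofReal R) :=
    hb1 (Metric.eball_subset_eball (ENNReal.ofReal_le_ofReal (by linarith)) hz)
  -- Room for the mean value inequality: a path of length less than `2 t` joining two points of a
  -- ball of radius `t` stays in the concentric ball of radius `3 t`.
  have hball : ∀ {x y z : M} {t : ℝ}, 0 < t → y ∈ Metric.eball x (ENNReal.ofReal t) →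
      z ∈ Metric.eball x (ENNReal.ofReal t) →
      Metric.eball y (ENNReal.ofReal (2 * t)) ⊆ Metric.eball x (ENNReal.ofReal (3 * t)) ∧
        edist y z < ENNReal.ofReal (2 * t) := by
    intro x y z t ht hy hz
    rw [Metric.mem_eball] at hy hz
    constructor
    · intro u hu
      rw [Metric.mem_eball] at *
      calc edist u x ≤ edist u y + edist y x := edist_triangle _ _ _
        _ < ENNReal.ofReal (2 * t) + ENNReal.ofReal t := ENNReal.add_lt_add hu hy
        _ = ENNReal.ofReal (3 * t) := by
          rw [← ENNReal.ofReal_add (by positivity) (by positivity)]; ring_nf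
    · calc edist y z ≤ edist y x + edist z x := edist_triangle_right _ _ _
        _ < ENNReal.ofReal t + ENNReal.ofReal t := ENNReal.add_lt_add hy hz
        _ = ENNReal.ofReal (2 * t) := by
          rw [← ENNReal.ofReal_add (by positivity) (by positivity)]; ring_nf
  have henorm : ∀ {x x' : M} (v : TangentSpace (𝓡 n) x) (v' : TangentSpace (𝓡 n) x') (c : ℝ),
      ‖v‖ ≤ c * ‖v'‖ → 0 ≤ c → ‖v‖ₑ ≤ ENNReal.ofReal c * ‖v'‖ₑ := by
    intro x x' v v' c hv hc
    rw [← ofReal_norm, ← ofReal_norm, ← ENNReal.ofReal_mul hc]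
    exact ENNReal.ofReal_le_ofReal hv
  constructor
  · refine edist_le_mul_of_enorm_mfderiv_le (I := 𝓡 n) (I' := 𝓡 n)
      (s := Metric.eball x (ENNReal.ofReal (3 * r))) (fun u _ ↦ (hf u).contMDiffAt)
      ENNReal.ofReal_ne_top ?_ (hball hr0 hy hz).1 (hball hr0 hy hz).2
    intro u hu w
    refine henorm _ _ _ ?_ (Real.exp_nonneg _)
    rw [hb]
    gcongr
    refine HolderOnWith.le_add_mul_rpow hC (hRs (hb1 hu)).1.1 (hRs hxU).1.1 (by positivity)
      (hu.le.trans (ENNReal.ofReal_le_ofReal ?_))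
    have : 0 ≤ 3 * (K₀ : ℝ) * K₁ := by positivity
    gcongr
    linarith
  · have hfball : ∀ y ∈ Metric.eball x (ENNReal.ofReal r), y ∈ Metric.eball p (ENNReal.ofReal R) →
        f y ∈ Metric.eball (f x) (ENNReal.ofReal (K₁ * r)) := by
      intro y hy hyU
      rw [Metric.mem_eball] at *
      calc edist (f y) (f x) ≤ K₁ * edist y x := hK₁ (hRs hyU).1.2 (hRs hxU).1.2
        _ < K₁ * ENNReal.ofReal r := by
          gcongr
          exact ENNReal.coe_ne_top
        _ = ENNReal.ofReal (K₁ * r) := by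
          rw [ENNReal.ofReal_mul K₁.coe_nonneg, ENNReal.ofReal_coe_nnreal]
    have hb' := hball (by positivity : 0 < K₁ * r) (hfball y hy hyU) (hfball z hz hzU)
    have key := edist_le_mul_of_enorm_mfderiv_le (I := 𝓡 n) (I' := 𝓡 n) (g := h)
      (s := Metric.eball (f x) (ENNReal.ofReal (3 * (K₁ * r))))
      (K := ENNReal.ofReal (Real.exp (-b x + C * (A * r) ^ (α : ℝ))))
      (fun u hu ↦ h.contMDiffOn_toFun.contMDiffAt (h.open_source.mem_nhds (hρs (hb2 hu)).1.1))
      ENNReal.ofReal_ne_top ?_ hb'.1 hb'.2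
    · rwa [(hf p).localInverse_left_inv (hRs hyU).2, (hf p).localInverse_left_inv (hRs hzU).2]
        at key
    intro u hu w
    refine henorm _ _ _ ?_ (Real.exp_nonneg _)
    rw [norm_mfderiv_localInverse hf hb (hρs (hb2 hu)).1.1]
    gcongr
    have hfxs : f x ∈ Metric.eball (f p) (ENNReal.ofReal ρ) :=
      hb2 (Metric.mem_eball_self (ENNReal.ofReal_pos.2 (by positivity)))
    have hxu : edist x (h u) ≤ ENNReal.ofReal (A * r) := by
      calc edist x (h u) = edist (h (f x)) (h u) := by
            rw [(hf p).localInverse_left_inv (hRs hxU).2]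
        _ ≤ K₀ * edist (f x) u := hK₀ (hρs hfxs).1.2 (hρs (hb2 hu)).1.2
        _ ≤ K₀ * ENNReal.ofReal (3 * (K₁ * r)) := by
          gcongr
          rw [edist_comm]
          exact hu.le
        _ = ENNReal.ofReal (K₀ * (3 * (K₁ * r))) := by
          rw [ENNReal.ofReal_mul K₀.coe_nonneg, ENNReal.ofReal_coe_nnreal]
        _ ≤ ENNReal.ofReal (A * r) := by
          apply ENNReal.ofReal_le_ofReal
          rw [hA]
          nlinarith
    have := HolderOnWith.le_add_mul_rpow hC (hRs hxU).1.1 (hρs (hb2 hu)).2 (by positivity) hxu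
    linarith

theorem exists_scalesDistancesOn_univ [CompactSpace M] {α : ℝ≥0} {f : M → M}
    (hf : IsLocalDiffeomorph (𝓡 n) (𝓡 n) 1 f) {b : M → ℝ}
    (hb : ∀ x, ∀ v : TangentSpace (𝓡 n) x, ‖mfderiv (𝓡 n) (𝓡 n) f x v‖ = Real.exp (b x) * ‖v‖)
    (hα : ∀ p, IsHolderNear α b p) :
    ∃ C : ℝ, ∃ δ : ℝ, 0 < δ ∧ ScalesDistancesOn α f b C δ univ := by
  refine isCompact_univ.induction_on
    (p := fun s ↦ ∃ C : ℝ, ∃ δ : ℝ, 0 < δ ∧ ScalesDistancesOn α f b C δ s) ?_ ?_ ?_ ?_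
  · exact ⟨0, 1, one_pos, fun x hx ↦ hx.elim⟩
  · rintro s t hst ⟨C, δ, hδ, h⟩
    exact ⟨C, δ, hδ, h.mono le_rfl le_rfl hst⟩
  · rintro s t ⟨C, δ, hδ, h⟩ ⟨C', δ', hδ', h'⟩
    refine ⟨max C C', min δ δ', lt_min hδ hδ', fun x hx ↦ ?_⟩
    rcases hx with hx | hx
    · exact h.mono (le_max_left _ _) (min_le_left _ _) subset_rfl x hx
    · exact h'.mono (le_max_right _ _) (min_le_right _ _) subset_rfl x hx
  · intro p _
    obtain ⟨C, δ, hδ, U, hU, h⟩ := exists_scalesDistancesOn_nhds hf hb (hα p)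
    exact ⟨U, mem_nhdsWithin_of_mem_nhds hU, C, δ, hδ, h⟩

end LocalEstimate

/-! ### Backward contraction and bounded distortion along orbits -/

section Dynamics

open Set

variable {X : Type*} [PseudoEMetricSpace X] {d : ℕ}

/-- A continuous open map of a compact space is uniformly open. -/
theorem exists_eball_subset_image_eball [CompactSpace X] {f : X → X} (hc : Continuous f)
    (ho : IsOpenMap f) {δ : ℝ} (hδ : 0 < δ) :
    ∃ δ' : ℝ, 0 < δ' ∧ ∀ x, Metric.eball (f x) (ENNReal.ofReal δ') ⊆
      f '' Metric.eball x (ENNReal.ofReal δ) := by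
  suffices ∃ δ' : ℝ, 0 < δ' ∧ ∀ x ∈ (univ : Set X), Metric.eball (f x) (ENNReal.ofReal δ') ⊆
      f '' Metric.eball x (ENNReal.ofReal δ) by simpa using this
  refine isCompact_univ.induction_on (p := fun s ↦ ∃ δ' : ℝ, 0 < δ' ∧ ∀ x ∈ s,
    Metric.eball (f x) (ENNReal.ofReal δ') ⊆ f '' Metric.eball x (ENNReal.ofReal δ)) ?_ ?_ ?_ ?_
  · exact ⟨1, one_pos, by simp⟩
  · rintro s t hst ⟨δ', h, h'⟩
    exact ⟨δ', h, fun x hx ↦ h' x (hst hx)⟩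
  · rintro s t ⟨δ₁, h₁, h₁'⟩ ⟨δ₂, h₂, h₂'⟩
    refine ⟨min δ₁ δ₂, lt_min h₁ h₂, fun x hx ↦ ?_⟩
    rcases hx with hx | hx
    · exact (Metric.eball_subset_eball (ENNReal.ofReal_le_ofReal (min_le_left _ _))).trans (h₁' x hx)
    · exact (Metric.eball_subset_eball (ENNReal.ofReal_le_ofReal (min_le_right _ _))).trans
        (h₂' x hx)
  · intro p _
    have hp : f '' Metric.eball p (ENNReal.ofReal (δ / 2)) ∈ 𝓝 (f p) :=
      ho.image_mem_nhds (Metric.eball_mem_nhds p (by simpa using hδ))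
    obtain ⟨ρ, hρ, hρs⟩ := exists_eball_ofReal_subset hp
    refine ⟨Metric.eball p (ENNReal.ofReal (δ / 2)) ∩
      f ⁻¹' Metric.eball (f p) (ENNReal.ofReal (ρ / 2)), mem_nhdsWithin_of_mem_nhds
      (inter_mem (Metric.eball_mem_nhds p (by simpa using hδ))
      (hc.continuousAt (Metric.eball_mem_nhds _ (by simpa using hρ)))), ρ / 2, by positivity, ?_⟩
    rintro x ⟨hx, hfx⟩ z hz
    have : z ∈ Metric.eball (f p) (ENNReal.ofReal ρ) := by
      rw [mem_preimage] at hfx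
      rw [Metric.mem_eball] at *
      calc edist z (f p) ≤ edist z (f x) + edist (f x) (f p) := edist_triangle _ _ _
        _ < ENNReal.ofReal (ρ / 2) + ENNReal.ofReal (ρ / 2) := ENNReal.add_lt_add hz hfx
        _ = ENNReal.ofReal ρ := by
          rw [← ENNReal.ofReal_add (by positivity) (by positivity), add_halves]
    obtain ⟨y, hy, rfl⟩ := hρs this
    refine ⟨y, ?_, rfl⟩
    rw [Metric.mem_eball] at *
    calc edist y x ≤ edist y p + edist x p := edist_triangle_right _ _ _
      _ < ENNReal.ofReal (δ / 2) + ENNReal.ofReal (δ / 2) := ENNReal.add_lt_add hy hx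
      _ = ENNReal.ofReal δ := by
        rw [← ENNReal.ofReal_add (by positivity) (by positivity), add_halves]

variable {f : Fin d → X → X} {b : Fin d → X → ℝ} {α : ℝ≥0} {C δ δ' c : ℝ}

/-- Backward contraction along an orbit: each point of a ball of uniform radius around the `N`-th
point of the orbit is reached by an orbit which gets exponentially close backwards. -/
theorem exists_backward_orbit (hf : ∀ i, ScalesDistancesOn α (f i) (b i) C δ univ)
    (hδ : 0 < δ) (hCδ : C * δ ^ (α : ℝ) ≤ c / 2) (hc : 0 ≤ c)
    (hsub : ∀ i x, Metric.eball (f i x) (ENNReal.ofReal δ') ⊆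
      f i '' Metric.eball x (ENNReal.ofReal δ))
    (w : ℕ → Fin d) (x : X) {N : ℕ}
    (hN : ∀ k ≤ N, c * (N - k) ≤ ∑ i ∈ Finset.Ico k N, b (w i) (orbitalBranch f w i x))
    {z : X} (hz : z ∈ Metric.eball (orbitalBranch f w N x) (ENNReal.ofReal δ')) :
    ∃ y, orbitalBranch f w N y = z ∧ ∀ k ≤ N,
      edist (orbitalBranch f w k y) (orbitalBranch f w k x) ≤
        ENNReal.ofReal (Real.exp (-(c / 2) * (N - k))) * edist z (orbitalBranch f w N x) := by
  -- As `C * δ ^ α ≤ c / 2`, one inverse step costs at most the factor `exp (c / 2 - b)`. At a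
  -- hyperbolic time the accumulated exponent is still at most `-(c / 2) (N - k)`.
  set S : ℕ → ℝ := fun k ↦ ∑ i ∈ Finset.Ico k N, (c / 2 - b (w i) (orbitalBranch f w i x)) with hS
  have hSle : ∀ k ≤ N, S k ≤ -(c / 2) * (N - k) := by
    intro k hk
    have := hN k hk
    simp only [hS, Finset.sum_sub_distrib, Finset.sum_const, Nat.card_Ico, nsmul_eq_mul]
    rw [Nat.cast_sub hk]
    linarith
  -- The orbit `ζ` is built backwards from `z`, and only its values from `k` to `N` matter. The
  -- contraction already gained keeps each point within `δ'` of the reference orbit, so another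
  -- preimage can be taken.
  have key : ∀ k ≤ N, ∃ ζ : ℕ → X, ζ N = z ∧
      (∀ i, k ≤ i → i < N → f (w i) (ζ i) = ζ (i + 1)) ∧
      ∀ i, k ≤ i → i ≤ N → edist (ζ i) (orbitalBranch f w i x) ≤
        ENNReal.ofReal (Real.exp (S i)) * edist z (orbitalBranch f w N x) := by
    intro k hk
    induction hk using Nat.decreasingInduction with
    | self =>
      refine ⟨fun _ ↦ z, rfl, fun i hi hi' ↦ absurd hi' (not_lt.2 hi), fun i hi hi' ↦ ?_⟩
      obtain rfl : i = N := le_antisymm hi' hi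
      simp [hS]
    | of_succ k hk ih =>
      obtain ⟨ζ, hζN, hζ, hζd⟩ := ih
      have h1 := hζd (k + 1) le_rfl hk
      have hmem : ζ (k + 1) ∈ Metric.eball (f (w k) (orbitalBranch f w k x))
          (ENNReal.ofReal δ') := by
        rw [Metric.mem_eball]
        refine lt_of_le_of_lt (h1.trans ?_) hz
        have : Real.exp (S (k + 1)) ≤ 1 := by
          rw [Real.exp_le_one_iff]
          refine (hSle (k + 1) hk).trans ?_
          have : ((k + 1 : ℕ) : ℝ) ≤ N := by exact_mod_cast hk
          nlinarith
        calc ENNReal.ofReal (Real.exp (S (k + 1))) * edist z (orbitalBranch f w N x)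
            ≤ 1 * edist z (orbitalBranch f w N x) := by
              gcongr
              exact ENNReal.ofReal_le_one.2 this
          _ = _ := one_mul _
      obtain ⟨y, hy, hyz⟩ := hsub _ _ hmem
      have h2 := (hf (w k) (orbitalBranch f w k x) trivial δ hδ le_rfl y hy
        (orbitalBranch f w k x) (Metric.mem_eball_self (by simpa using hδ))).2
      refine ⟨Function.update ζ k y, ?_, ?_, ?_⟩
      · rw [Function.update_of_ne hk.ne', hζN]
      · intro i hi hi'
        rcases hi.eq_or_lt with rfl | hlt
        · simp [hyz]
        · rw [Function.update_of_ne hlt.ne', Function.update_of_ne (by omega)]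
          exact hζ i hlt hi'
      · intro i hi hi'
        rcases hi.eq_or_lt with rfl | hlt
        · rw [Function.update_self]
          refine h2.trans ?_
          rw [hyz]
          have hSk : S k = (c / 2 - b (w k) (orbitalBranch f w k x)) + S (k + 1) := by
            simp only [hS]
            rw [Finset.sum_eq_sum_Ico_succ_bot hk]
          rw [hSk, Real.exp_add (c / 2 - _), ENNReal.ofReal_mul (Real.exp_nonneg _), mul_assoc]
          refine mul_le_mul' (ENNReal.ofReal_le_ofReal (Real.exp_le_exp.2 (by linarith))) h1
        · rw [Function.update_of_ne hlt.ne']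
          exact hζd i hlt hi'
  obtain ⟨ζ, hζN, hζ, hζd⟩ := key 0 (Nat.zero_le _)
  have horb : ∀ k ≤ N, orbitalBranch f w k (ζ 0) = ζ k := by
    intro k
    induction k with
    | zero => intro _; rfl
    | succ k ih =>
      intro hk
      rw [orbitalBranch, Function.comp_apply, ih (by omega), hζ k (Nat.zero_le _) hk]
  refine ⟨ζ 0, by rw [horb N le_rfl, hζN], fun k hk ↦ ?_⟩
  rw [horb k hk]
  refine (hζd k (Nat.zero_le _) hk).trans ?_
  gcongr
  exact hSle k hk

/-- Bounded distortion along orbits which stay exponentially close to each other backwards. -/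
theorem edist_orbitalBranch_le (hf : ∀ i, ScalesDistancesOn α (f i) (b i) C δ univ)
    (hC : 0 ≤ C) (hα : 0 < α) (hc : 0 < c) (hδ'0 : 0 < δ') (hδ' : δ' ≤ δ)
    (w : ℕ → Fin d) (x : X) {N : ℕ} {y z : X}
    (hy : ∀ k < N, orbitalBranch f w k y ∈ Metric.eball (orbitalBranch f w k x)
      (ENNReal.ofReal (δ' * Real.exp (-(c / 2) * (N - k)))))
    (hz : ∀ k < N, orbitalBranch f w k z ∈ Metric.eball (orbitalBranch f w k x)
      (ENNReal.ofReal (δ' * Real.exp (-(c / 2) * (N - k))))) :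
    edist (orbitalBranch f w N y) (orbitalBranch f w N z) ≤
      ENNReal.ofReal (Real.exp (C * δ' ^ (α : ℝ) * (1 - Real.exp (-(c / 2) * α))⁻¹ +
        ∑ i ∈ Finset.range N, b (w i) (orbitalBranch f w i x))) * edist y z ∧
    edist y z ≤
      ENNReal.ofReal (Real.exp (C * δ' ^ (α : ℝ) * (1 - Real.exp (-(c / 2) * α))⁻¹ -
        ∑ i ∈ Finset.range N, b (w i) (orbitalBranch f w i x))) *
        edist (orbitalBranch f w N y) (orbitalBranch f w N z) := by
  set r : ℕ → ℝ := fun k ↦ δ' * Real.exp (-(c / 2) * (N - k)) with hr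
  set B : ℕ → ℝ := fun i ↦ b (w i) (orbitalBranch f w i x) with hB
  set q : ℝ := Real.exp (-(c / 2) * α) with hq
  have hα' : (0 : ℝ) < α := hα
  have hq1 : q < 1 := by
    rw [hq, Real.exp_lt_one_iff]
    nlinarith
  have hq0 : 0 ≤ q := Real.exp_nonneg _
  have hsum : ∑ i ∈ Finset.range N, C * r i ^ (α : ℝ) ≤ C * δ' ^ (α : ℝ) * (1 - q)⁻¹ := by
    have h1 : ∀ i ∈ Finset.range N, C * r i ^ (α : ℝ) = C * δ' ^ (α : ℝ) * q ^ (N - i) := by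
      intro i hi
      have hi' : i ≤ N := (Finset.mem_range.1 hi).le
      simp only [hr]
      rw [Real.mul_rpow hδ'0.le (Real.exp_nonneg _), ← Real.exp_mul, hq, ← Real.exp_nat_mul,
        Nat.cast_sub hi', ← mul_assoc]
      congr 2
      ring
    rw [Finset.sum_congr rfl h1, ← Finset.mul_sum]
    refine mul_le_mul_of_nonneg_left ?_ (by positivity)
    -- The term `i = N` is added so that reversing the order gives a plain geometric sum.
    calc ∑ i ∈ Finset.range N, q ^ (N - i) ≤ ∑ i ∈ Finset.range (N + 1), q ^ (N - i) :=
          Finset.sum_le_sum_of_subset_of_nonneg (Finset.range_subset_range.2 (by omega))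
            fun _ _ _ ↦ by positivity
      _ = ∑ i ∈ Finset.range (N + 1), q ^ i := Finset.sum_range_reflect (fun i ↦ q ^ i) (N + 1)
      _ ≤ ∑' i, q ^ i := (summable_geometric_of_lt_one hq0 hq1).sum_le_tsum _
            fun _ _ ↦ by positivity
      _ = (1 - q)⁻¹ := tsum_geometric_of_lt_one hq0 hq1
  have hstep : ∀ k ≤ N, edist (orbitalBranch f w k y) (orbitalBranch f w k z) ≤
      ENNReal.ofReal (Real.exp (∑ i ∈ Finset.range k, (B i + C * r i ^ (α : ℝ)))) * edist y z ∧
      edist y z ≤ ENNReal.ofReal (Real.exp (∑ i ∈ Finset.range k, (-B i + C * r i ^ (α : ℝ)))) *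
        edist (orbitalBranch f w k y) (orbitalBranch f w k z) := by
    intro k
    induction k with
    | zero => intro _; simp [orbitalBranch]
    | succ k ih =>
      intro hk
      obtain ⟨ih1, ih2⟩ := ih (by omega)
      have hrδ : r k ≤ δ := by
        refine le_trans ?_ hδ'
        have : Real.exp (-(c / 2) * (N - k)) ≤ 1 := by
          rw [Real.exp_le_one_iff]
          have : (k : ℝ) ≤ N := by exact_mod_cast (by omega : k ≤ N)
          nlinarith
        exact mul_le_of_le_one_right hδ'0.le this
      obtain ⟨h1, h2⟩ := hf (w k) (orbitalBranch f w k x) trivial (r k) (by positivity) hrδ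
        _ (hy k hk) _ (hz k hk)
      simp only [orbitalBranch, Function.comp_apply, Finset.sum_range_succ]
      rw [Real.exp_add, ENNReal.ofReal_mul (Real.exp_nonneg _),
        Real.exp_add (∑ i ∈ Finset.range k, (-B i + C * r i ^ (α : ℝ))),
        ENNReal.ofReal_mul (Real.exp_nonneg _)]
      constructor
      · refine h1.trans ?_
        rw [mul_comm (ENNReal.ofReal _) (ENNReal.ofReal _), mul_assoc]
        gcongr
      · refine ih2.trans ?_
        rw [mul_assoc]
        gcongr
  obtain ⟨h1, h2⟩ := hstep N le_rfl
  simp only [Finset.sum_add_distrib, Finset.sum_neg_distrib] at h1 h2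
  constructor
  · refine h1.trans ?_
    gcongr ENNReal.ofReal (Real.exp ?_) * _
    linarith
  · refine h2.trans ?_
    gcongr ENNReal.ofReal (Real.exp ?_) * _
    linarith

end Dynamics

/-! ### From a density point of an invariant set to a full ball -/

section InvariantSets

open Set

variable {X : Type*} {d : ℕ} {f : Fin d → X → X} {b : Fin d → X → ℝ} {α : ℝ≥0}

theorem orbitalBranch_mem {A : Set X} (hA : ∀ i, ∀ x ∈ A, f i x ∈ A) (w : ℕ → Fin d) (N : ℕ) {x : X}
    (hx : x ∈ A) : orbitalBranch f w N x ∈ A := by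
  induction N with
  | zero => exact hx
  | succ N ih => exact hA _ _ ih

/-- Infinitely many `N` are record times of the partial sums of `B - c`, since these tend to
infinity. At a record time every final block of `B - c` has nonnegative sum. -/
theorem frequently_le_sum_Ico {B : ℕ → ℝ} {c : ℝ}
    (h : Tendsto (fun k ↦ ∑ i ∈ Finset.range k, (B i - c)) atTop atTop) :
    ∃ᶠ N : ℕ in atTop, ∀ k ≤ N, c * (N - k) ≤ ∑ i ∈ Finset.Ico k N, B i := by
  refine (frequently_high_scores h).mono fun N hN k hk ↦ ?_
  have h1 : ∑ i ∈ Finset.range k, (B i - c) ≤ ∑ i ∈ Finset.range N, (B i - c) := by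
    rcases hk.eq_or_lt with rfl | hlt
    · exact le_rfl
    · exact (hN k hlt).le
  rw [← Finset.sum_range_add_sum_Ico _ hk, Finset.sum_sub_distrib (s := Finset.Ico k N)] at h1
  simp only [Finset.sum_const, Nat.card_Ico, nsmul_eq_mul] at h1
  rw [Nat.cast_sub hk] at h1
  linarith

variable [EMetricSpace X] [MeasurableSpace X] [BorelSpace X]

/-- The images of small neighbourhoods of `x` under the orbital branch fill a ball of uniform
radius around the `N`-th point of the orbit, with bounded distortion. -/
theorem hausdorffMeasure_eball_diff_le {n : ℕ} {C δ δ' c : ℝ}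
    (hf : ∀ i, ScalesDistancesOn α (f i) (b i) C δ univ)
    (hC : 0 ≤ C) (hα : 0 < α) (hc : 0 < c) (hδ : 0 < δ) (hδ'0 : 0 < δ') (hδ' : δ' ≤ δ)
    (hCδ : C * δ ^ (α : ℝ) ≤ c / 2)
    (hsub : ∀ i x, Metric.eball (f i x) (ENNReal.ofReal δ') ⊆
      f i '' Metric.eball x (ENNReal.ofReal δ))
    {A : Set X} (hA : ∀ i, ∀ x ∈ A, f i x ∈ A)
    (w : ℕ → Fin d) (x : X) {N : ℕ}
    (hN : ∀ k ≤ N, c * (N - k) ≤ ∑ i ∈ Finset.Ico k N, b (w i) (orbitalBranch f w i x))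
    {Λ D : ℝ} (hΛ : Λ = ∑ i ∈ Finset.range N, b (w i) (orbitalBranch f w i x))
    (hD : D = C * δ' ^ (α : ℝ) * (1 - Real.exp (-(c / 2) * α))⁻¹) :
    μH[n] (Metric.eball (orbitalBranch f w N x) (ENNReal.ofReal δ') \ A) ≤
      ENNReal.ofReal (Real.exp (D + Λ)) ^ n *
        μH[n] (Metric.closedEBall x (ENNReal.ofReal (Real.exp (D - Λ) * δ')) \ A) := by
  -- On these points, whose orbits shadow that of `x` at exponentially small scales, the distortion
  -- bound applies.
  set V : Set X := {y | ∀ k < N, orbitalBranch f w k y ∈ Metric.eball (orbitalBranch f w k x)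
      (ENNReal.ofReal (δ' * Real.exp (-(c / 2) * (N - k))))} with hV
  have hxV : x ∈ V := fun k _ ↦ Metric.mem_eball_self (ENNReal.ofReal_pos.2 (by positivity))
  have hLip : LipschitzOnWith (Real.toNNReal (Real.exp (D + Λ))) (orbitalBranch f w N) V := by
    intro y hy z hz
    have := (edist_orbitalBranch_le hf hC hα hc hδ'0 hδ' w x hy hz).1
    rwa [← hΛ, ← hD] at this
  have hsubset : Metric.eball (orbitalBranch f w N x) (ENNReal.ofReal δ') \ A ⊆
      orbitalBranch f w N ''
        ((Metric.closedEBall x (ENNReal.ofReal (Real.exp (D - Λ) * δ')) \ A) ∩ V) := by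
    rintro z ⟨hz, hzA⟩
    obtain ⟨y, hyz, hy⟩ := exists_backward_orbit hf hδ hCδ hc.le hsub w x hN hz
    have hyV : y ∈ V := by
      intro k hk
      rw [Metric.mem_eball, mul_comm δ', ENNReal.ofReal_mul (Real.exp_nonneg _)]
      refine (hy k hk.le).trans_lt ?_
      exact ENNReal.mul_lt_mul_right (ENNReal.ofReal_pos.2 (Real.exp_pos _)).ne'
        ENNReal.ofReal_ne_top hz
    refine ⟨y, ⟨⟨?_, fun hyA ↦ hzA (hyz ▸ orbitalBranch_mem hA w N hyA)⟩, hyV⟩, hyz⟩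
    have := (edist_orbitalBranch_le hf hC hα hc hδ'0 hδ' w x hyV hxV).2
    rw [← hΛ, ← hD, hyz] at this
    rw [Metric.mem_closedEBall, ENNReal.ofReal_mul (Real.exp_nonneg _)]
    refine this.trans ?_
    gcongr
    exact hz.le
  calc μH[n] (Metric.eball (orbitalBranch f w N x) (ENNReal.ofReal δ') \ A)
      ≤ μH[n] (orbitalBranch f w N ''
        ((Metric.closedEBall x (ENNReal.ofReal (Real.exp (D - Λ) * δ')) \ A) ∩ V)) :=
        measure_mono hsubset
    _ ≤ (Real.toNNReal (Real.exp (D + Λ)) : ℝ≥0∞) ^ (n : ℝ) *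
        μH[n] ((Metric.closedEBall x (ENNReal.ofReal (Real.exp (D - Λ) * δ')) \ A) ∩ V) :=
        (hLip.mono inter_subset_right).hausdorffMeasure_image_le (Nat.cast_nonneg n)
    _ ≤ _ := by
        rw [ENNReal.rpow_natCast]
        exact mul_le_mul' le_rfl (measure_mono inter_subset_left)

/-- A forward invariant set with an expanding density point contains an open ball, up to a null
set. -/
theorem exists_eball_diff_null [CompactSpace X] {n : ℕ}
    (hf : ∀ i, ∃ C : ℝ, ∃ δ : ℝ, 0 < δ ∧ ScalesDistancesOn α (f i) (b i) C δ univ)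
    (hcont : ∀ i, Continuous (f i)) (hopen : ∀ i, IsOpenMap (f i)) (hα : 0 < α)
    {A : Set X} (hA : ∀ i, ∀ x ∈ A, f i x ∈ A) {w : ℕ → Fin d} {x : X} {c : ℝ} (hc : 0 < c)
    (hexp : Tendsto (fun k ↦ ∑ i ∈ Finset.range k, (b (w i) (orbitalBranch f w i x) - c))
      atTop atTop)
    (hdens : Tendsto (fun ρ : ℝ ↦ μH[n] (Metric.closedEBall x (ENNReal.ofReal ρ) \ A) /
      ENNReal.ofReal (ρ ^ n)) (𝓝[>] 0) (𝓝 0)) :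
    ∃ y : X, ∃ ε : ℝ, 0 < ε ∧ μH[n] (Metric.eball y (ENNReal.ofReal ε) \ A) = 0 := by
  have hα' : (0 : ℝ) < α := hα
  choose C' δ₀ hδ₀ hf using hf
  -- uniform constants
  obtain ⟨C, hC0, hC⟩ : ∃ C : ℝ, 0 ≤ C ∧ ∀ i, C' i ≤ C := by
    refine ⟨∑ i, |C' i|, Finset.sum_nonneg fun _ _ ↦ abs_nonneg _, fun i ↦ ?_⟩
    exact (le_abs_self _).trans
      (Finset.single_le_sum (f := fun i ↦ |C' i|) (fun _ _ ↦ abs_nonneg _) (Finset.mem_univ i))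
  have hsmall : ∀ᶠ δ : ℝ in 𝓝[>] 0, C * δ ^ (α : ℝ) < c / 2 := by
    have : Tendsto (fun δ : ℝ ↦ C * δ ^ (α : ℝ)) (𝓝 0) (𝓝 (C * 0 ^ (α : ℝ))) :=
      ((Real.continuousAt_rpow_const 0 _ (Or.inr hα'.le)).const_mul C)
    rw [Real.zero_rpow hα'.ne', mul_zero] at this
    exact (this.mono_left nhdsWithin_le_nhds).eventually (gt_mem_nhds (by positivity))
  obtain ⟨δ, ⟨hCδ, hδi⟩, hδ⟩ := ((hsmall.and (eventually_all.2 fun i ↦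
    (Ioc_mem_nhdsGT (hδ₀ i)))).and self_mem_nhdsWithin).exists
  have hδ : 0 < δ := hδ
  have hf' : ∀ i, ScalesDistancesOn α (f i) (b i) C δ univ := fun i ↦
    (hf i).mono (hC i) (hδi i).2 subset_rfl
  choose ρ hρ hρs using fun i ↦ exists_eball_subset_image_eball (hcont i) (hopen i) hδ
  obtain ⟨δ', ⟨hδ'i, hδ'δ⟩, hδ'0⟩ := (((eventually_all.2 fun i ↦ (Ioc_mem_nhdsGT (hρ i))).and
    (Ioc_mem_nhdsGT hδ)).and self_mem_nhdsWithin).exists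
  have hδ'0 : 0 < δ' := hδ'0
  have hsub : ∀ i x, Metric.eball (f i x) (ENNReal.ofReal δ') ⊆
      f i '' Metric.eball x (ENNReal.ofReal δ) := fun i x ↦
    (Metric.eball_subset_eball (ENNReal.ofReal_le_ofReal (hδ'i i).2)).trans (hρs i x)
  set D : ℝ := C * δ' ^ (α : ℝ) * (1 - Real.exp (-(c / 2) * α))⁻¹ with hD
  set Λ : ℕ → ℝ := fun N ↦ ∑ i ∈ Finset.range N, b (w i) (orbitalBranch f w i x) with hΛ
  set P : Set ℕ := {N | ∀ k ≤ N, c * (N - k) ≤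
    ∑ i ∈ Finset.Ico k N, b (w i) (orbitalBranch f w i x)} with hP
  -- Limits are taken along the hyperbolic times only, which form an infinite set.
  have hNeBot : (atTop ⊓ 𝓟 P).NeBot := frequently_mem_iff_neBot.1 (frequently_le_sum_Ico hexp)
  have hΛtop : Tendsto Λ atTop atTop := by
    refine tendsto_atTop_mono (fun k ↦ ?_) hexp
    rw [Finset.sum_sub_distrib]
    simp only [Finset.sum_const, Finset.card_range, nsmul_eq_mul, hΛ]
    have : 0 ≤ (k : ℝ) * c := by positivity
    linarith
  have hrad : Tendsto (fun N ↦ Real.exp (D - Λ N) * δ') atTop (𝓝[>] 0) := by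
    refine tendsto_nhdsWithin_iff.2 ⟨?_, Eventually.of_forall fun N ↦ mem_Ioi.2 (by positivity)⟩
    have h1 : Tendsto (fun N ↦ D - Λ N) atTop atBot := by
      simpa [sub_eq_add_neg] using tendsto_atBot_add_const_left atTop D
        (tendsto_neg_atTop_atBot.comp hΛtop)
    simpa using (Real.tendsto_exp_atBot.comp h1).mul_const δ'
  -- With `ρ = exp (D - Λ N) * δ'`, the factor `exp (D + Λ N) ^ n` equals `(exp (2 D) * δ') ^ n / ρ
  -- ^ n`, so the density hypothesis at `x` gives the limit.
  have hlim : Tendsto (fun N ↦ μH[n] (Metric.eball (orbitalBranch f w N x) (ENNReal.ofReal δ') \ A))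
      (atTop ⊓ 𝓟 P) (𝓝 0) := by
    have h1 := ENNReal.Tendsto.const_mul
      (a := ENNReal.ofReal ((Real.exp (2 * D) * δ') ^ n))
      (hdens.comp (hrad.mono_left inf_le_left : Tendsto _ (atTop ⊓ 𝓟 P) _))
      (Or.inr ENNReal.ofReal_ne_top)
    rw [mul_zero] at h1
    refine tendsto_of_tendsto_of_tendsto_of_le_of_le' tendsto_const_nhds h1
      (Eventually.of_forall fun _ ↦ zero_le) ?_
    have hPmem : ∀ᶠ N in atTop ⊓ 𝓟 P, N ∈ P := mem_inf_of_right (mem_principal_self P)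
    filter_upwards [hPmem] with N hN
    refine (hausdorffMeasure_eball_diff_le hf' hC0 hα hc hδ hδ'0 hδ'δ.2 hCδ.le hsub hA w x hN
      (rfl : Λ N = _) hD).trans_eq ?_
    have hpos : 0 < Real.exp (D - Λ N) * δ' := by positivity
    simp only [Function.comp_apply]
    rw [ENNReal.div_eq_inv_mul, ← mul_assoc]
    congr 1
    rw [← ENNReal.ofReal_inv_of_pos (by positivity), ← ENNReal.ofReal_mul (by positivity),
      ← ENNReal.ofReal_pow (Real.exp_nonneg _)]
    congr 1
    rw [← inv_pow, ← mul_pow]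
    congr 1
    rw [mul_inv, ← Real.exp_neg, show D + Λ N = 2 * D + -(D - Λ N) by ring, Real.exp_add]
    field_simp
  -- The balls of radius `δ'` have moving centers. Around a cluster point `y` of the centers, the
  -- ball of radius `δ' / 2` lies in those with center within `δ' / 2` of `y`.
  obtain ⟨y, hy⟩ := exists_clusterPt_of_compactSpace
    (map (fun N ↦ orbitalBranch f w N x) (atTop ⊓ 𝓟 P))
  refine ⟨y, δ' / 2, by positivity, ?_⟩
  refine le_antisymm (ENNReal.le_of_forall_pos_le_add fun ε hε _ ↦ ?_) zero_le
  have hfreq : ∃ᶠ N in atTop ⊓ 𝓟 P,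
      orbitalBranch f w N x ∈ Metric.eball y (ENNReal.ofReal (δ' / 2)) :=
    hy.frequently (Metric.eball_mem_nhds y (ENNReal.ofReal_pos.2 (by positivity)))
  obtain ⟨N, hN, hNε⟩ := (hfreq.and_eventually
    (hlim.eventually (gt_mem_nhds (ENNReal.coe_pos.2 hε)))).exists
  rw [zero_add]
  refine (measure_mono (sdiff_subset_sdiff_left fun z hz ↦ ?_)).trans hNε.le
  rw [Metric.mem_eball] at *
  calc edist z (orbitalBranch f w N x) ≤ edist z y + edist (orbitalBranch f w N x) y :=
        edist_triangle_right _ _ _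
    _ < ENNReal.ofReal (δ' / 2) + ENNReal.ofReal (δ' / 2) := ENNReal.add_lt_add hz hN
    _ = ENNReal.ofReal δ' := by
        rw [← ENNReal.ofReal_add (by positivity) (by positivity), add_halves]

end InvariantSets

/-! ### Null sets, absolute continuity and Lebesgue density -/

section NullSets

open Set

/-- Locally Lipschitz maps preserve null sets of the Hausdorff measures. -/
theorem hausdorffMeasure_image_null {X Y : Type*} [EMetricSpace X] [MeasurableSpace X]
    [BorelSpace X] [SecondCountableTopology X] [EMetricSpace Y] [MeasurableSpace Y] [BorelSpace Y]
    {g : X → Y} {s : Set X} {r : ℝ} (hr : 0 ≤ r)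
    (hg : ∀ p ∈ s, ∃ K : ℝ≥0, ∃ U ∈ 𝓝 p, LipschitzOnWith K g U) (hs : μH[r] s = 0) :
    μH[r] (g '' s) = 0 := by
  choose! K U hU hK using hg
  obtain ⟨t, hts, htc, hst⟩ := TopologicalSpace.countable_cover_nhdsWithin
    fun x hx ↦ mem_nhdsWithin_of_mem_nhds (hU x hx)
  have h1 : g '' s ⊆ ⋃ x ∈ t, g '' (U x ∩ s) := by
    rintro _ ⟨y, hy, rfl⟩
    obtain ⟨x, hx, hyx⟩ := mem_iUnion₂.1 (hst hy)
    exact mem_iUnion₂.2 ⟨x, hx, y, ⟨hyx, hy⟩, rfl⟩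
  refine measure_mono_null h1 ((measure_biUnion_null_iff htc).2 fun x hx ↦ ?_)
  refine le_antisymm ?_ zero_le
  calc μH[r] (g '' (U x ∩ s)) ≤ (K x : ℝ≥0∞) ^ r * μH[r] (U x ∩ s) :=
        ((hK x (hts hx)).mono inter_subset_left).hausdorffMeasure_image_le hr
    _ = 0 := by rw [measure_mono_null inter_subset_right hs, mul_zero]

/-- A supremum of measures that are absolutely continuous with respect to `ν` is absolutely
continuous with respect to `ν`. -/
theorem iSup_absolutelyContinuous {X ι : Type*} [MeasurableSpace X] {μ : ι → Measure X}
    {ν : Measure X} (h : ∀ i, μ i ≪ ν) : (⨆ i, μ i) ≪ ν := by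
  refine Measure.AbsolutelyContinuous.mk fun s hs hνs ↦ ?_
  -- Each `μ i` ignores `s`, so the restriction to `sᶜ` is already an upper bound of the family; it
  -- gives `s` measure zero.
  have hle : (⨆ i, μ i) ≤ (⨆ i, μ i).restrict sᶜ := by
    refine iSup_le fun i ↦ Measure.le_iff.2 fun t ht ↦ ?_
    rw [Measure.restrict_apply ht]
    calc μ i t ≤ μ i (t ∩ sᶜ) + μ i s := by
          refine (measure_mono ?_).trans (measure_union_le _ _)
          intro x hx
          by_cases hxs : x ∈ s
          · exact Or.inr hxs
          · exact Or.inl ⟨hx, hxs⟩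
      _ = μ i (t ∩ sᶜ) := by rw [h i hνs, add_zero]
      _ ≤ (⨆ i, μ i) (t ∩ sᶜ) := Measure.le_iff'.1 (le_iSup μ i) _
  refine le_antisymm ((Measure.le_iff'.1 hle s).trans_eq ?_) zero_le
  rw [Measure.restrict_apply hs, inter_compl_self, measure_empty]

theorem chartVolume_apply {n : ℕ} {M : Type*} [TopologicalSpace M]
    [ChartedSpace (EuclideanSpace ℝ (Fin n)) M]
    [RiemannianBundle (fun x : M ↦ TangentSpace (𝓡 n) x)] [MeasurableSpace M] [BorelSpace M] (x : M) {s : Set M} (hs : MeasurableSet s) :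
    chartVolume (n := n) x s =
      ((volume.restrict (chartAt (EuclideanSpace ℝ (Fin n)) x).target).withDensity
        fun u ↦ ENNReal.ofReal √(metricMatrix x u).det)
        ((chartAt (EuclideanSpace ℝ (Fin n)) x).symm ⁻¹' s) := by
  refine Measure.map_apply_of_aemeasurable ?_ hs
  refine AEMeasurable.mono_ac ?_ (withDensity_absolutelyContinuous _ _)
  exact (chartAt (EuclideanSpace ℝ (Fin n)) x).continuousOn_symm.aemeasurable
    (chartAt (EuclideanSpace ℝ (Fin n)) x).open_target.measurableSet

instance isContinuousRiemannianBundle_euclideanSpace (n : ℕ) :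
    IsContinuousRiemannianBundle (EuclideanSpace ℝ (Fin n))
      (fun x : EuclideanSpace ℝ (Fin n) ↦ TangentSpace (𝓡 n) x) :=
  ⟨(riemannianMetricVectorSpace (EuclideanSpace ℝ (Fin n))).inner,
    (riemannianMetricVectorSpace (EuclideanSpace ℝ (Fin n))).contMDiff.continuous,
    fun _ _ _ ↦ rfl⟩

variable {n : ℕ} {M : Type*} [EMetricSpace M] [ChartedSpace (EuclideanSpace ℝ (Fin n)) M]
  [IsManifold (𝓡 n) ∞ M] [RiemannianBundle (fun x : M ↦ TangentSpace (𝓡 n) x)]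
  [IsContMDiffRiemannianBundle (𝓡 n) ∞ (EuclideanSpace ℝ (Fin n))
    (fun x : M ↦ TangentSpace (𝓡 n) x)] [IsRiemannianManifold (𝓡 n) M]

theorem exists_lipschitzOnWith_chartAt (x : M) {p : M}
    (hp : p ∈ (chartAt (EuclideanSpace ℝ (Fin n)) x).source) :
    ∃ K : ℝ≥0, ∃ U ∈ 𝓝 p, LipschitzOnWith K (chartAt (EuclideanSpace ℝ (Fin n)) x) U := by
  have : IsManifold (𝓡 n) 1 M := IsManifold.of_le (n := ∞) (by simp)
  have : IsContinuousRiemannianBundle (EuclideanSpace ℝ (Fin n))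
    (fun x : M ↦ TangentSpace (𝓡 n) x) := isContinuousRiemannianBundle_of_contMDiff
  exact exists_lipschitzOnWith_of_contMDiffAt (n := n)
    (contMDiffAt_of_mem_maximalAtlas (IsManifold.chart_mem_maximalAtlas x) hp)

theorem exists_lipschitzOnWith_chartAt_symm (x : M) {u : EuclideanSpace ℝ (Fin n)}
    (hu : u ∈ (chartAt (EuclideanSpace ℝ (Fin n)) x).target) :
    ∃ K : ℝ≥0, ∃ U ∈ 𝓝 u, LipschitzOnWith K (chartAt (EuclideanSpace ℝ (Fin n)) x).symm U := by
  have : IsManifold (𝓡 n) 1 M := IsManifold.of_le (n := ∞) (by simp)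
  have : IsContinuousRiemannianBundle (EuclideanSpace ℝ (Fin n))
    (fun x : M ↦ TangentSpace (𝓡 n) x) := isContinuousRiemannianBundle_of_contMDiff
  exact exists_lipschitzOnWith_of_contMDiffAt (n := n)
    (contMDiffOn_chart_symm.contMDiffAt
      ((chartAt (EuclideanSpace ℝ (Fin n)) x).open_target.mem_nhds hu))

variable [MeasurableSpace M] [BorelSpace M]

/-- Charts are locally Lipschitz, hence send `μH[n]`-null sets to `μH[n]`-null sets, and on
Euclidean space `volume` and `μH[n]` are both Haar measures. -/
theorem chartVolume_absolutelyContinuous [SecondCountableTopology M] (x : M) :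
    chartVolume (n := n) x ≪ (μH[n] : Measure M) := by
  set φ := chartAt (EuclideanSpace ℝ (Fin n)) x with hφ
  refine Measure.AbsolutelyContinuous.mk fun s hs hμs ↦ ?_
  rw [chartVolume_apply x hs]
  refine withDensity_absolutelyContinuous _ _ ?_
  rw [← hφ, Measure.restrict_apply' φ.open_target.measurableSet]
  refine Measure.absolutelyContinuous_isAddHaarMeasure volume
    (μH[n] : Measure (EuclideanSpace ℝ (Fin n))) ?_
  refine measure_mono_null (t := φ '' (s ∩ φ.source)) ?_ ?_
  · rintro u ⟨hu, hut⟩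
    exact ⟨φ.symm u, ⟨hu, φ.map_target hut⟩, φ.right_inv hut⟩
  · exact hausdorffMeasure_image_null (Nat.cast_nonneg n)
      (fun p hp ↦ exists_lipschitzOnWith_chartAt x hp.2) (measure_mono_null inter_subset_left hμs)

theorem riemannianVolume_absolutelyContinuous [SecondCountableTopology M] :
    riemannianVolume n M ≪ (μH[n] : Measure M) :=
  iSup_absolutelyContinuous chartVolume_absolutelyContinuous

/-- **Lebesgue density theorem** for the Hausdorff measure of a Riemannian manifold. -/
theorem ae_tendsto_hausdorffMeasure_closedEBall_diff [SecondCountableTopology M] {A : Set M}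
    (hA : MeasurableSet A) :
    ∀ᵐ x ∂(μH[n] : Measure M), x ∈ A →
      Tendsto (fun ρ : ℝ ↦ μH[n] (Metric.closedEBall x (ENNReal.ofReal ρ) \ A) /
        ENNReal.ofReal (ρ ^ n)) (𝓝[>] 0) (𝓝 0) := by
  rw [ae_iff]
  refine measure_null_of_locally_null _ fun p _ ↦ ?_
  set φ := chartAt (EuclideanSpace ℝ (Fin n)) p with hφ
  obtain ⟨K₁', U₁, hU₁, hK₁'⟩ :=
    exists_lipschitzOnWith_chartAt (n := n) p (mem_chart_source _ p)
  rw [← hφ] at hK₁'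
  obtain ⟨K₁, hK₁pos, hK₁⟩ : ∃ K₁ : ℝ≥0, 0 < K₁ ∧ LipschitzOnWith K₁ φ U₁ :=
    ⟨K₁' + 1, by positivity, hK₁'.weaken (by simp)⟩
  obtain ⟨K₂, U₂, hU₂, hK₂⟩ := exists_lipschitzOnWith_chartAt_symm (n := n) p
    (φ.map_source (mem_chart_source _ p))
  rw [← hφ] at hK₂
  obtain ⟨U, hUsub, hUo, hpU⟩ := mem_nhds_iff.1 (inter_mem (inter_mem hU₁
    (φ.open_source.mem_nhds (mem_chart_source _ p)))
    (φ.continuousAt (mem_chart_source _ p) hU₂))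
  set ν : Measure (EuclideanSpace ℝ (Fin n)) := μH[n] with hν
  set A' : Set (EuclideanSpace ℝ (Fin n)) := φ.target ∩ φ.symm ⁻¹' (A ∩ U) with hA'
  have hA'm : MeasurableSet A' := by
    have h := (continuousOn_iff_continuous_domRestrict.1 φ.continuousOn_symm).measurable
      (hA.inter hUo.measurableSet)
    have h' := MeasurableSet.subtype_image φ.open_target.measurableSet h
    convert h' using 1
    ext u
    simp [hA']
    tauto
  -- The Euclidean density theorem is applied to the complement of `A'`, whose density is `0` at
  -- almost every point of `A'`; the exceptional set is carried back by the locally Lipschitz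
  -- inverse chart.
  have hdens := Besicovitch.ae_tendsto_measure_inter_div_of_measurableSet ν hA'm.compl
  rw [ae_iff] at hdens
  set B := {u | ¬Tendsto (fun r ↦ ν (A'ᶜ ∩ Metric.closedBall u r) / ν (Metric.closedBall u r))
    (𝓝[>] 0) (𝓝 (A'ᶜ.indicator 1 u))} with hB
  refine ⟨_, inter_mem_nhdsWithin _ (hUo.mem_nhds hpU), ?_⟩
  refine measure_mono_null (t := φ.symm '' (B ∩ φ.target)) ?_
    (hausdorffMeasure_image_null (Nat.cast_nonneg n)
      (fun u hu ↦ exists_lipschitzOnWith_chartAt_symm p hu.2)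
      (measure_mono_null inter_subset_left hdens))
  rintro x ⟨hx, hxU⟩
  refine ⟨φ x, ⟨fun hxB ↦ hx fun hxA ↦ ?_, φ.map_source (hUsub hxU).1.2⟩,
    φ.left_inv (hUsub hxU).1.2⟩
  have hxA' : φ x ∈ A' :=
    ⟨φ.map_source (hUsub hxU).1.2, by
      rw [mem_preimage, φ.left_inv (hUsub hxU).1.2]; exact ⟨hxA, hxU⟩⟩
  rw [indicator_of_notMem (by simpa using hxA')] at hxB
  have hmul : Tendsto (fun ρ : ℝ ↦ K₁ * ρ) (𝓝[>] 0) (𝓝[>] 0) := by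
    refine tendsto_nhdsWithin_iff.2 ⟨?_, ?_⟩
    · have : Tendsto (fun ρ : ℝ ↦ K₁ * ρ) (𝓝 0) (𝓝 (K₁ * 0)) := tendsto_id.const_mul _
      rw [mul_zero] at this
      exact this.mono_left nhdsWithin_le_nhds
    · filter_upwards [self_mem_nhdsWithin] with ρ hρ
      have : (0 : ℝ) < ρ := hρ
      exact mem_Ioi.2 (by positivity)
  have hball_ne : ν (Metric.ball 0 1) ≠ 0 := (Metric.measure_ball_pos ν 0 one_pos).ne'
  have hball_top : ν (Metric.ball 0 1) ≠ ⊤ := measure_ball_lt_top.ne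
  -- `K₂ ^ n` pays for leaving the chart, and the other factor turns `ρ ^ n` into the measure of a
  -- ball of radius `K₁ * ρ`.
  have hlim := ENNReal.Tendsto.const_mul
    (a := (K₂ : ℝ≥0∞) ^ n * (ENNReal.ofReal ((K₁ : ℝ) ^ n) * ν (Metric.ball 0 1)))
    (hxB.comp hmul) (Or.inr (by finiteness))
  rw [mul_zero] at hlim
  refine tendsto_of_tendsto_of_tendsto_of_le_of_le' tendsto_const_nhds hlim
    (Eventually.of_forall fun _ ↦ zero_le) ?_
  obtain ⟨ρ₀, hρ₀, hρ₀U⟩ := exists_eball_ofReal_subset (hUo.mem_nhds hxU)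
  filter_upwards [Ioo_mem_nhdsGT hρ₀] with ρ hρ
  have hρ0 : 0 < ρ := hρ.1
  have hsub : Metric.closedEBall x (ENNReal.ofReal ρ) ⊆ U := by
    intro y hy
    refine hρ₀U (Metric.mem_eball.2 (lt_of_le_of_lt (Metric.mem_closedEBall.1 hy) ?_))
    rw [ENNReal.ofReal_lt_ofReal_iff hρ₀]
    exact hρ.2
  have hincl : Metric.closedEBall x (ENNReal.ofReal ρ) \ A ⊆
      φ.symm '' ((A'ᶜ ∩ Metric.closedBall (φ x) (K₁ * ρ)) ∩ U₂) := by
    rintro y ⟨hy, hyA⟩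
    have hyU := hsub hy
    have hinv := φ.left_inv (hUsub hyU).1.2
    refine ⟨φ y, ⟨⟨fun h ↦ hyA ?_, ?_⟩, (hUsub hyU).2⟩, hinv⟩
    · have := h.2.1
      rwa [hinv] at this
    · rw [Metric.mem_closedBall, ← edist_le_ofReal (by positivity),
        ENNReal.ofReal_mul K₁.coe_nonneg, ENNReal.ofReal_coe_nnreal]
      refine (hK₁ (hUsub hyU).1.1 (hUsub hxU).1.1).trans ?_
      gcongr
      exact hy
  have h1 : μH[n] (Metric.closedEBall x (ENNReal.ofReal ρ) \ A) ≤
      (K₂ : ℝ≥0∞) ^ n * ν (A'ᶜ ∩ Metric.closedBall (φ x) (K₁ * ρ)) := by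
    refine (measure_mono hincl).trans ?_
    refine ((hK₂.mono inter_subset_right).hausdorffMeasure_image_le (Nat.cast_nonneg n)).trans ?_
    rw [ENNReal.rpow_natCast]
    exact mul_le_mul' le_rfl (measure_mono inter_subset_left)
  have h2 : ν (Metric.closedBall (φ x) (K₁ * ρ)) =
      ENNReal.ofReal ((K₁ : ℝ) ^ n) * ν (Metric.ball 0 1) * ENNReal.ofReal (ρ ^ n) := by
    rw [Measure.addHaar_closedBall ν _ (by positivity), finrank_euclideanSpace_fin, mul_pow,
      ENNReal.ofReal_mul (by positivity)]
    ring
  simp only [Function.comp_apply]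
  rw [h2]
  set c := ENNReal.ofReal ((K₁ : ℝ) ^ n) * ν (Metric.ball 0 1) with hc
  have hc0 : c ≠ 0 := mul_ne_zero (ENNReal.ofReal_pos.2 (by positivity)).ne' hball_ne
  have hct : c ≠ ⊤ := by finiteness
  refine (ENNReal.div_le_div_right h1 _).trans_eq ?_
  rw [ENNReal.div_eq_inv_mul, ENNReal.div_eq_inv_mul, ENNReal.mul_inv (Or.inl hc0) (Or.inl hct)]
  calc _ = (K₂ : ℝ≥0∞) ^ n * (1 * (ENNReal.ofReal (ρ ^ n))⁻¹ *
        ν (A'ᶜ ∩ Metric.closedBall (φ x) (K₁ * ρ))) := by ring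
    _ = _ := by
        rw [← ENNReal.mul_inv_cancel hc0 hct]
        ring

end NullSets

/-! ### Expansion along orbits and proof of ergodicity -/

section Ergodicity

open Set

theorem exists_tendsto_sum_sub_atTop {B : ℕ → ℝ}
    (h : limsup (fun k : ℕ ↦ (((1 / (k : ℝ)) * ∑ i ∈ Finset.range k, -B i : ℝ) : EReal)) atTop
      < 0) :
    ∃ c > 0, Tendsto (fun k ↦ ∑ i ∈ Finset.range k, (B i - c)) atTop atTop := by
  obtain ⟨e, he, he0⟩ := EReal.lt_iff_exists_real_btwn.1 h
  have he0 : e < 0 := by exact_mod_cast he0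
  -- Eventually the sum of `B` exceeds `-e * k`; giving up half of this rate leaves linear growth.
  refine ⟨-e / 2, by linarith, ?_⟩
  have hlin : Tendsto (fun k : ℕ ↦ (-e / 2) * (k : ℝ)) atTop atTop :=
    tendsto_natCast_atTop_atTop.const_mul_atTop (by linarith)
  refine tendsto_atTop_mono' _ ?_ hlin
  filter_upwards [eventually_lt_of_limsup_lt he, eventually_gt_atTop 0] with k hk hk0
  have hk : (1 / (k : ℝ)) * ∑ i ∈ Finset.range k, -B i < e := by exact_mod_cast hk
  have hk0 : (0 : ℝ) < k := by exact_mod_cast hk0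
  rw [one_div, inv_mul_lt_iff₀ hk0, Finset.sum_neg_distrib] at hk
  rw [Finset.sum_sub_distrib]
  simp only [Finset.sum_const, Finset.card_range, nsmul_eq_mul]
  linarith

variable {n : ℕ} {M : Type*} {d : ℕ}

theorem tangentSpace_nontrivial [TopologicalSpace M] [ChartedSpace (EuclideanSpace ℝ (Fin n)) M]
    (hn : 0 < n) (x : M) : Nontrivial (TangentSpace (𝓡 n) x) := by
  have : Nonempty (Fin n) := ⟨⟨0, hn⟩⟩
  exact inferInstanceAs (Nontrivial (EuclideanSpace ℝ (Fin n)))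

/-- The derivative of a conformal local diffeomorphism is a similarity, of positive ratio. -/
theorem IsConformal.exists_logFactor [TopologicalSpace M]
    [ChartedSpace (EuclideanSpace ℝ (Fin n)) M]
    [RiemannianBundle (fun x : M ↦ TangentSpace (𝓡 n) x)] (hn : 0 < n) {g : M → M}
    (hg : IsConformal n g) (hd : IsLocalDiffeomorph (𝓡 n) (𝓡 n) 1 g) :
    ∃ b : M → ℝ, (∀ x, ∀ v : TangentSpace (𝓡 n) x,
      ‖mfderiv (𝓡 n) (𝓡 n) g x v‖ = Real.exp (b x) * ‖v‖) ∧
      ∀ x, Real.log ‖(mfderiv (𝓡 n) (𝓡 n) g x).inverse‖ = -b x := by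
  obtain ⟨a, ha⟩ := hg
  choose T hT using ha
  have hnorm : ∀ x, ∀ v : TangentSpace (𝓡 n) x,
      ‖mfderiv (𝓡 n) (𝓡 n) g x v‖ = |a x| * ‖v‖ := by
    intro x v
    rw [hT, norm_smul, Real.norm_eq_abs, (T x).norm_map]
  have ha0 : ∀ x, 0 < |a x| := by
    intro x
    have := tangentSpace_nontrivial hn x
    obtain ⟨v, hv⟩ := exists_ne (0 : TangentSpace (𝓡 n) x)
    rw [abs_pos]
    intro h0
    have h1 : mfderiv (𝓡 n) (𝓡 n) g x v = 0 := by
      rw [hT, h0, zero_smul]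
    rw [← (hd x).mfderivToContinuousLinearEquiv_coe one_ne_zero] at h1
    exact hv (((hd x).mfderivToContinuousLinearEquiv one_ne_zero).map_eq_zero_iff.1 h1)
  refine ⟨fun x ↦ Real.log |a x|, fun x v ↦ by rw [Real.exp_log (ha0 x), hnorm], fun x ↦ ?_⟩
  have := tangentSpace_nontrivial hn (g x)
  set e := (hd x).mfderivToContinuousLinearEquiv one_ne_zero with he
  have hinv : (mfderiv (𝓡 n) (𝓡 n) g x).inverse = (e.symm : _ →L[ℝ] _) := by
    rw [← (hd x).mfderivToContinuousLinearEquiv_coe one_ne_zero]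
    exact ContinuousLinearMap.inverse_equiv e
  have hs : ∀ w, ‖(e.symm : TangentSpace (𝓡 n) (g x) →L[ℝ] TangentSpace (𝓡 n) x) w‖ =
      |a x|⁻¹ * ‖w‖ := by
    intro w
    have h1 := hnorm x (e.symm w)
    have h2 : mfderiv (𝓡 n) (𝓡 n) g x (e.symm w) = w := e.apply_symm_apply w
    rw [h2] at h1
    rw [h1, inv_mul_cancel_left₀ (ha0 x).ne']
    rfl
  rw [hinv, ContinuousLinearMap.homothety_norm _ hs, Real.log_inv]

theorem generatedSemigroup_induction {f : Fin d → M → M} {P : (M → M) → Prop}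
    (hf : ∀ i, P (f i)) (hcomp : ∀ g h, P g → P h → P (g ∘ h)) {g : M → M}
    (hg : g ∈ generatedSemigroup f) : P g := by
  induction hg using Subsemigroup.closure_induction with
  | mem x hx =>
    obtain ⟨i, rfl⟩ := hx
    exact hf i
  | mul x y _ _ hx hy => exact hcomp x y hx hy

theorem isErgodicAction_of_isRiemannianManifold [EMetricSpace M] [CompactSpace M]
    [ChartedSpace (EuclideanSpace ℝ (Fin n)) M] [IsManifold (𝓡 n) ∞ M]
    [RiemannianBundle (fun x : M ↦ TangentSpace (𝓡 n) x)]
    [IsContMDiffRiemannianBundle (𝓡 n) ∞ (EuclideanSpace ℝ (Fin n))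
      (fun x : M ↦ TangentSpace (𝓡 n) x)] [IsRiemannianManifold (𝓡 n) M]
    [MeasurableSpace M] [BorelSpace M] (hn : 0 < n)
    (f : Fin d → M → M) (α : ℝ≥0) (hα0 : 0 < α) (hα1 : α ≤ 1)
    (hf : ∀ i, IsC1HolderLocalDiffeomorph n α (f i))
    (hconf : ∀ i, IsConformal n (f i))
    (hexact : IsExactAction (generatedSemigroup f) (lebesgueMeasure n M))
    (hexp : IsNonUniformlyExpandable n f (lebesgueMeasure n M)) :
    IsErgodicAction (generatedSemigroup f) (lebesgueMeasure n M) := by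
  have : IsManifold (𝓡 n) 1 M := IsManifold.of_le (n := ∞) (by simp)
  have : IsContinuousRiemannianBundle (EuclideanSpace ℝ (Fin n))
    (fun x : M ↦ TangentSpace (𝓡 n) x) := isContinuousRiemannianBundle_of_contMDiff
  have : SecondCountableTopology M := EMetric.secondCountable_of_sigmaCompact M
  intro A hA hinv
  set m := lebesgueMeasure n M with hm
  rcases eq_or_ne (m A) 0 with hA0 | hA0
  · exact Or.inl hA0
  right
  -- If the total volume were `0` or `⊤`, the normalized measure would be zero, against `m A ≠ 0`.
  -- Positivity and finiteness thus need no separate proof.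
  have hvol0 : riemannianVolume n M univ ≠ 0 := by
    intro h
    rw [Measure.measure_univ_eq_zero] at h
    simp [hm, lebesgueMeasure, h] at hA0
  have hvolt : riemannianVolume n M univ ≠ ⊤ := by
    intro h
    simp [hm, lebesgueMeasure, h] at hA0
  have hmuniv : m univ = 1 := by
    rw [hm, lebesgueMeasure, Measure.smul_apply, smul_eq_mul, ENNReal.inv_mul_cancel hvol0 hvolt]
  have hmH : m ≪ (μH[n] : Measure M) :=
    Measure.AbsolutelyContinuous.smul_left riemannianVolume_absolutelyContinuous _
  -- an expanding density point
  choose b hb hlog using fun i ↦ (hconf i).exists_logFactor hn (hf i).1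
  -- The density theorem needs a measurable set, while invariance holds for `A`. Density at a point
  -- of `A₁ ⊆ A` passes to `A`, whose complement is smaller.
  obtain ⟨A₁, hA₁A, hA₁m, hA₁⟩ := hA.exists_measurable_subset_ae_eq
  have hA₁0 : m A₁ ≠ 0 := by rwa [measure_congr hA₁]
  obtain ⟨x, hxA₁, ⟨w, hw⟩, hdens⟩ :=
    Measure.exists_mem_of_measure_ne_zero_of_ae hA₁0
    (ae_restrict_of_ae (hexp.and (hmH.ae_le (ae_tendsto_hausdorffMeasure_closedEBall_diff hA₁m))))
  simp only [hlog] at hw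
  obtain ⟨c, hc, hsum⟩ := exists_tendsto_sum_sub_atTop hw
  have hdensA : Tendsto (fun ρ : ℝ ↦ μH[n] (Metric.closedEBall x (ENNReal.ofReal ρ) \ A) /
      ENNReal.ofReal (ρ ^ n)) (𝓝[>] 0) (𝓝 0) := by
    refine tendsto_of_tendsto_of_tendsto_of_le_of_le tendsto_const_nhds (hdens hxA₁)
      (fun _ ↦ zero_le) fun ρ ↦ ?_
    exact ENNReal.div_le_div_right (measure_mono (sdiff_subset_sdiff_right hA₁A)) _
  obtain ⟨y, ε, hε, hy⟩ := exists_eball_diff_null (n := n)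
    (fun i ↦ exists_scalesDistancesOn_univ (hf i).1 (hb i)
      (isHolderNear_logFactor hn hα0 hα1 (hf i).2 (hb i)))
    (fun i ↦ (hf i).1.contMDiff.continuous) (fun i ↦ (hf i).1.isOpenMap) hα0
    (fun i z hz ↦ hinv (f i) (Subsemigroup.subset_closure ⟨i, rfl⟩) ⟨z, hz, rfl⟩) hc hsum hdensA
  -- spreading the ball
  obtain ⟨g, hg, hcover⟩ := hexact (Metric.eball y (ENNReal.ofReal ε)) Metric.isOpen_eball
    ⟨y, Metric.mem_eball_self (ENNReal.ofReal_pos.2 hε)⟩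
  have hnull : ∀ g : M → M, g ∈ generatedSemigroup f → ∀ s : Set M, μH[n] s = 0 →
      μH[n] (g '' s) = 0 := by
    intro g hg
    refine generatedSemigroup_induction
      (P := fun g : M → M ↦ ∀ s : Set M, μH[n] s = 0 → μH[n] (g '' s) = 0) ?_ ?_ hg
    · intro i s hs
      exact hausdorffMeasure_image_null (Nat.cast_nonneg n)
        (fun p _ ↦ exists_lipschitzOnWith_of_contMDiffAt (n := n) ((hf i).1 p).contMDiffAt) hs
    · intro g h hg hh s hs
      rw [image_comp]
      exact hg _ (hh _ hs)
  have hcompl : m Aᶜ = 0 := by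
    -- By invariance, a covered point outside `A` is the image of a point of the ball outside `A`.
    refine measure_mono_null (t := (⋃ k, g k '' Metric.eball y (ENNReal.ofReal ε))ᶜ ∪
      ⋃ k, g k '' (Metric.eball y (ENNReal.ofReal ε) \ A)) ?_ (measure_union_null hcover
        (measure_iUnion_null fun k ↦ hmH (hnull _ (hg k) _ hy)))
    intro z hz
    by_cases hzc : z ∈ ⋃ k, g k '' Metric.eball y (ENNReal.ofReal ε)
    · obtain ⟨k, u, hu, rfl⟩ := mem_iUnion.1 hzc
      refine Or.inr (mem_iUnion.2 ⟨k, u, ⟨hu, fun huA ↦ hz ?_⟩, rfl⟩)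
      exact hinv (g k) (hg k) ⟨u, huA, rfl⟩
    · exact Or.inl hzc
  rw [← hmuniv]
  exact measure_congr (eventuallyEq_univ.2 (mem_ae_iff.2 hcompl))

end Ergodicity

end SemigroupErgodicity

end

/-! ### Dimension zero, and passage to the Riemannian distance -/

open SemigroupErgodicity in
theorem theoremC {n : ℕ} {M : Type*} [TopologicalSpace M] [T2Space M] [CompactSpace M]
    [ChartedSpace (EuclideanSpace ℝ (Fin n)) M] [IsManifold (𝓡 n) ∞ M]
    [RiemannianBundle (fun x : M ↦ TangentSpace (𝓡 n) x)]
    [IsContMDiffRiemannianBundle (𝓡 n) ∞ (EuclideanSpace ℝ (Fin n))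
      (fun x : M ↦ TangentSpace (𝓡 n) x)]
    [MeasurableSpace M] [BorelSpace M]
    {d : ℕ} (f : Fin d → M → M) (α : ℝ≥0) (hα0 : 0 < α) (hα1 : α ≤ 1)
    (hf : ∀ i, IsC1HolderLocalDiffeomorph n α (f i))
    (hconf : ∀ i, IsConformal n (f i))
    (hexact : IsExactAction (generatedSemigroup f) (lebesgueMeasure n M))
    (hexp : IsNonUniformlyExpandable n f (lebesgueMeasure n M)) :
    IsErgodicAction (generatedSemigroup f) (lebesgueMeasure n M) := by
  rcases Nat.eq_zero_or_pos n with rfl | hn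
  · -- in dimension `0` no point is expandable, so that the measure vanishes
    intro A _ _
    left
    have hm : lebesgueMeasure 0 M = 0 := by
      rw [← ae_eq_bot, ← Filter.empty_mem_iff_bot]
      filter_upwards [hexp] with x hx
      obtain ⟨w, hw⟩ := hx
      -- Every operator between trivial tangent spaces has norm `0`, and `Real.log 0 = 0` by
      -- convention, so the `limsup` is `0` and not negative.
      have h0 : ∀ i y, Real.log ‖(mfderiv (𝓡 0) (𝓡 0) (f i) y).inverse‖ = 0 := by
        intro i y
        have : Subsingleton (TangentSpace (𝓡 0) (f i y)) :=
          inferInstanceAs (Subsingleton (EuclideanSpace ℝ (Fin 0)))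
        rw [ContinuousLinearMap.opNorm_subsingleton, Real.log_zero]
      simp [h0] at hw
    rw [hm]
    rfl
  · have : IsManifold (𝓡 n) 1 M := IsManifold.of_le (n := ∞) (by simp)
    have : IsContinuousRiemannianBundle (EuclideanSpace ℝ (Fin n))
      (fun x : M ↦ TangentSpace (𝓡 n) x) := isContinuousRiemannianBundle_of_contMDiff
    -- The distance is extended because `M` need not be connected.
    let : EMetricSpace M := EMetricSpace.ofRiemannianMetric (𝓡 n) M
    have : IsRiemannianManifold (𝓡 n) M := ⟨fun _ _ ↦ rfl⟩
    exact isErgodicAction_of_isRiemannianManifold hn f α hα0 hα1 hf hconf hexact hexp
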